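/- \textbf{Conventions.} A set $P\subseteq\mathbb N^{\mathbb N}$ is $\Pi^0_1$ if it is the set of infinite paths of a computable tree $T\subseteq\mathbb N^{<\mathbb N}$; we regard $2^{\mathbb N}\subseteq\mathbb N^{\mathbb N}$. $P$ is \emph{special} if it is nonempty and has no computable member. Let $(\Phi_e)_{e\in\mathbb N}$ be an effective enumeration of all Turing functionals on $\mathbb N^{\mathbb N}$, and let $(\Psi_e)_{e\in\mathbb N}$ be an effective enumeration of all \emph{learners}, i.e. of all partial computable functions $\mathbb N^{<\mathbb N}\to\mathbb N$. For a partial function $\Gamma:\subseteq\mathbb N^{\mathbb N}\to\mathbb N^{\mathbb N}$ and $g\in\operatorname{dom}(\Gamma)$, the learner $\Psi_e$ \emph{identifies} $\Gamma$ on $g$ if $i=\lim_n\Psi_e(g\restriction n)$ converges and $\Phi_i(g)=\Gamma(g)$. $\Gamma$ is \emph{learnable by a finite team} (or $(<\omega,\omega)$-computable) if there is $b\in\mathbb N$ such that for every $g\in\operatorname{dom}(\Gamma)$ some $\Psi_e$ with $e<b$ identifies $\Gamma$ on $g$. $\Gamma$ is \emph{nonuniformly computable} (or $(\omega,1)$-computable)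 if $\Gamma(g)\le_T g$ for every $g\in\operatorname{dom}(\Gamma)$. Write $P\le^{<\omega}_\omega Q$ (respectively $P\le^\omega_1 Q$, Muchnik reducibility) if there is a partial function $\Gamma$ that is learnable by a finite team (respectively nonuniformly computable) such that $\Gamma(g)$ is defined and $\Gamma(g)\in P$ for every $g\in Q$. Write $P\equiv^\omega_1 Q$ if $P\le^\omega_1 Q$ and $Q\le^\omega_1 P$. Let $\widehat{\mathrm{Deg}}(P)=\{g\in 2^{\mathbb N}:(\exists f\in P)\; f\le_T g\}$ be the Turing upward closure of $P$. \textbf{Theorem.} \begin{enumerate} \item For all special $\Pi^0_1$ sets $P,Q\subseteq 2^{\mathbb N}$ there is a $\Pi^0_1$ set $\widehat P\subseteq 2^{\mathbb N}$ such that $\widehat P\equiv^\omega_1 P$ and $Q\not\le^{<\omega}_\omega\widehat P$. \item Consequently the LEVEL 4 separation holds between nonuniformly computable functions and functions learnable by a finite team: for every special $\Pi^0_1$ set $Y\subseteq 2^{\mathbb N}$ there is a $\Pi^0_1$ set $X\subseteq 2^{\mathbb N}$ such that $Y\le^\omega_1 X$ but $Y\not\le^{<\omega}_\omega X$. \item For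 all nonempty $\Pi^0_1$ sets $P,Q\subseteq 2^{\mathbb N}$, if $Q\le^{<\omega}_\omega\widehat{\mathrm{Deg}}(P)$ then $Q$ contains a computable element. \end{enumerate} -/

import Mathlib

/-- The initial segment `⟨f 0, …, f (n - 1)⟩` of length `n` of `f`. -/
def initSeg (f : ℕ → ℕ) (n : ℕ) : List ℕ := (List.range n).map f

/-! ### Turing functionals -/

/-- The `e`-th Turing functional `Φ_e`, presented by finite oracle information: `Φ_e(g; n)` is
computed by dovetailing, over all lengths `l` and step bounds `s`, the first `s` steps of the
`e`-th program on the input `(⟨g 0, …, g (l - 1)⟩, n)`, and returning the first output found. -/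
def turingFunctional (e : ℕ) (g : ℕ → ℕ) : ℕ →. ℕ := fun n =>
  Nat.rfindOpt fun k =>
    Nat.Partrec.Code.evaln k.unpair.2 (Denumerable.ofNat Nat.Partrec.Code e)
      (Nat.pair (Encodable.encode (initSeg g k.unpair.1)) n)

/-- `Φ_e(g) = h` for a total function `h`. -/
def FunctionalEq (e : ℕ) (g h : ℕ → ℕ) : Prop := ∀ n, h n ∈ turingFunctional e g n

/-- Turing reducibility `f ≤_T g` of elements of Baire space. -/
def TuringLE (f g : ℕ → ℕ) : Prop := TuringReducible (f : ℕ →. ℕ) (g : ℕ →. ℕ)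

/-! The following lemmas check that `Φ_0, Φ_1, …` is an enumeration of all Turing functionals. -/

/-- `F` computes `h` from longer and longer initial segments of the oracle `g`. -/
def ApproxFrom (g : ℕ → ℕ) (h : ℕ →. ℕ) (F : List ℕ → ℕ →. ℕ) : Prop :=
  (∀ l l' n m, l ≤ l' → m ∈ F (initSeg g l) n → m ∈ F (initSeg g l') n) ∧
    ∀ n m, m ∈ h n ↔ ∃ l, m ∈ F (initSeg g l) n

theorem initSeg_getElem? (g : ℕ → ℕ) (l n m : ℕ) :
    m ∈ (initSeg g l)[n]? ↔ n < l ∧ g n = m := by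
  simp [initSeg]
  grind

theorem ApproxFrom.exists_of_recursiveIn {g : ℕ → ℕ} {h : ℕ →. ℕ}
    (H : Nat.RecursiveIn {(g : ℕ →. ℕ)} h) :
    ∃ F : List ℕ → ℕ →. ℕ, Partrec₂ F ∧ ApproxFrom g h F := by
  have triv : ∀ {h : ℕ →. ℕ}, Nat.Partrec h →
      ∃ F : List ℕ → ℕ →. ℕ, Partrec₂ F ∧ ApproxFrom g h F := by
    intro h hp
    refine ⟨fun _ n => h n, (Partrec.nat_iff.2 hp).comp Computable.snd, ?_, ?_⟩
    · intro l l' n m _ hm; exact hm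
    · intro n m; simp
  induction H with
  | zero => exact triv .zero
  | succ => exact triv .succ
  | left => exact triv .left
  | right => exact triv .right
  | oracle f hf =>
    rw [Set.mem_singleton_iff] at hf
    subst hf
    refine ⟨fun σ n => ((σ[n]? : Option ℕ) : Part ℕ), ?_, ?_, ?_⟩
    · exact (Computable.list_getElem?.comp Computable.fst Computable.snd).ofOption
    · intro l l' n m hl hm
      rw [Part.mem_coe, initSeg_getElem?] at *
      exact ⟨by omega, hm.2⟩
    · intro n m
      simp only [Part.mem_coe, initSeg_getElem?, PFun.coe_val, Part.mem_some_iff]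
      exact ⟨fun h => ⟨n + 1, by omega, h.symm⟩, fun ⟨_, _, h⟩ => h.symm⟩
  | @pair f₁ f₂ _ _ ih₁ ih₂ =>
    obtain ⟨F, hF, mF, cF⟩ := ih₁
    obtain ⟨G, hG, mG, cG⟩ := ih₂
    have key : ∀ (a b : Part ℕ) m, m ∈ (Nat.pair <$> a <*> b) ↔
        ∃ x ∈ a, ∃ y ∈ b, Nat.pair x y = m := by
      intro a b m
      simp [Seq.seq, eq_comm]
    refine ⟨fun σ n => Nat.pair <$> F σ n <*> G σ n, ?_, ?_, ?_⟩
    · have := Partrec.bind (f := fun p : List ℕ × ℕ => F p.1 p.2)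
        (g := fun p x => (G p.1 p.2).map (Nat.pair x)) hF
        ((hG.comp (Computable.fst.comp Computable.fst) (Computable.snd.comp Computable.fst)).map
          (Primrec₂.natPair.to_comp.comp (Computable.snd.comp Computable.fst) Computable.snd))
      refine this.of_eq fun p => Part.ext fun m => ?_
      rw [key]; simp
    · intro l l' n m hl hm
      rw [key] at *
      obtain ⟨x, hx, y, hy, e⟩ := hm
      exact ⟨x, mF _ _ _ _ hl hx, y, mG _ _ _ _ hl hy, e⟩
    · intro n m
      simp only [key]
      constructor
      · rintro ⟨x, hx, y, hy, e⟩
        obtain ⟨l, hl⟩ := (cF _ _).1 hx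
        obtain ⟨l', hl'⟩ := (cG _ _).1 hy
        exact ⟨max l l', x, mF _ _ _ _ (le_max_left _ _) hl, y,
          mG _ _ _ _ (le_max_right _ _) hl', e⟩
      · rintro ⟨l, x, hx, y, hy, e⟩
        exact ⟨x, (cF _ _).2 ⟨l, hx⟩, y, (cG _ _).2 ⟨l, hy⟩, e⟩
  | @comp f₁ f₂ _ _ ih₁ ih₂ =>
    obtain ⟨F, hF, mF, cF⟩ := ih₁
    obtain ⟨G, hG, mG, cG⟩ := ih₂
    refine ⟨fun σ n => (G σ n).bind (F σ), ?_, ?_, ?_⟩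
    · exact Partrec.bind (f := fun p : List ℕ × ℕ => G p.1 p.2)
        (g := fun p x => F p.1 x) hG (hF.comp (Computable.fst.comp Computable.fst) Computable.snd)
    · intro l l' n m hl hm
      obtain ⟨x, hx, hy⟩ := Part.mem_bind_iff.1 hm
      exact Part.mem_bind_iff.2 ⟨x, mG _ _ _ _ hl hx, mF _ _ _ _ hl hy⟩
    · intro n m
      refine Part.mem_bind_iff.trans (Iff.trans ?_ (exists_congr fun l => Part.mem_bind_iff.symm))
      constructor
      · rintro ⟨x, hx, hy⟩
        obtain ⟨l, hl⟩ := (cG _ _).1 hx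
        obtain ⟨l', hl'⟩ := (cF _ _).1 hy
        exact ⟨max l l', x, mG _ _ _ _ (le_max_left _ _) hl,
          mF _ _ _ _ (le_max_right _ _) hl'⟩
      · rintro ⟨l, x, hx, hy⟩
        exact ⟨x, (cG _ _).2 ⟨l, hx⟩, (cF _ _).2 ⟨l, hy⟩⟩
  | @prec f₁ f₂ _ _ ih₁ ih₂ =>
    obtain ⟨F, hF, mF, cF⟩ := ih₁
    obtain ⟨G, hG, mG, cG⟩ := ih₂
    let R : List ℕ → ℕ → ℕ → Part ℕ := fun σ a n =>
      Nat.rec (F σ a) (fun y IH => IH.bind fun i => G σ (Nat.pair a (Nat.pair y i))) n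
    let R' : ℕ → ℕ → Part ℕ := fun a n =>
      Nat.rec (f₁ a) (fun y IH => IH.bind fun i => f₂ (Nat.pair a (Nat.pair y i))) n
    have mR : ∀ a n l l' m, l ≤ l' → m ∈ R (initSeg g l) a n → m ∈ R (initSeg g l') a n := by
      intro a n l l' m hl
      induction n generalizing m with
      | zero => exact mF _ _ _ _ hl
      | succ n ih =>
        simp only [R, Part.mem_bind_iff]
        rintro ⟨x, hx, hy⟩
        exact ⟨x, ih _ hx, mG _ _ _ _ hl hy⟩
    have cR : ∀ a n m, m ∈ R' a n ↔ ∃ l, m ∈ R (initSeg g l) a n := by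
      intro a n
      induction n with
      | zero => exact cF a
      | succ n ih =>
        intro m
        simp only [R, R', Part.mem_bind_iff]
        constructor
        · rintro ⟨x, hx, hy⟩
          obtain ⟨l, hl⟩ := (ih _).1 hx
          obtain ⟨l', hl'⟩ := (cG _ _).1 hy
          exact ⟨max l l', x, mR _ _ _ _ _ (le_max_left _ _) hl,
            mG _ _ _ _ (le_max_right _ _) hl'⟩
        · rintro ⟨l, x, hx, hy⟩
          exact ⟨x, (ih _).2 ⟨l, hx⟩, (cG _ _).2 ⟨l, hy⟩⟩
    refine ⟨fun σ p => R σ p.unpair.1 p.unpair.2, ?_, ?_, ?_⟩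
    · have u1 : Computable fun p : List ℕ × ℕ => p.2.unpair.1 :=
        (Computable.fst.comp Computable.unpair).comp Computable.snd
      have u2 : Computable fun p : List ℕ × ℕ => p.2.unpair.2 :=
        (Computable.snd.comp Computable.unpair).comp Computable.snd
      exact Partrec.nat_rec (f := fun p : List ℕ × ℕ => p.2.unpair.2)
        (g := fun p => F p.1 p.2.unpair.1)
        (h := fun p q => G p.1 (Nat.pair p.2.unpair.1 (Nat.pair q.1 q.2))) u2
        (hF.comp Computable.fst u1)
        (hG.comp (Computable.fst.comp Computable.fst)
          (Primrec₂.natPair.to_comp.comp (u1.comp Computable.fst)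
            (Primrec₂.natPair.to_comp.comp (Computable.fst.comp Computable.snd)
              (Computable.snd.comp Computable.snd))))
    · intro l l' n m hl hm
      exact mR _ _ _ _ _ hl hm
    · intro n m
      exact cR _ _ _
  | @rfind f₁ _ ih =>
    obtain ⟨F, hF, mF, cF⟩ := ih
    have key : ∀ (p : ℕ → Part ℕ) (m : ℕ),
        (m ∈ Nat.rfind fun n => (fun m => decide (m = 0)) <$> p n) ↔
        (∃ x ∈ p m, decide (x = 0) = true) ∧ ∀ k < m, ∃ x ∈ p k, decide (x = 0) = false := by
      intro p m
      refine Nat.mem_rfind.trans (and_congr (Part.mem_map_iff _) ?_)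
      exact forall_congr' fun k => forall_congr' fun _ => Part.mem_map_iff _
    refine ⟨fun σ a => Nat.rfind fun n => (fun m => decide (m = 0)) <$> F σ (Nat.pair a n),
      ?_, ?_, ?_⟩
    · refine Partrec.rfind (p := fun (p : List ℕ × ℕ) n =>
        (F p.1 (Nat.pair p.2 n)).map fun m => decide (m = 0)) ?_
      refine Partrec.map (f := fun q : (List ℕ × ℕ) × ℕ => F q.1.1 (Nat.pair q.1.2 q.2))
        (g := fun _ m => decide (m = 0)) ?_ ?_
      · exact hF.comp (Computable.fst.comp Computable.fst)
          (Primrec₂.natPair.to_comp.comp (Computable.snd.comp Computable.fst) Computable.snd)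
      · exact ((Primrec.eq (α := ℕ)).decide.comp Primrec.snd (Primrec.const 0)).to_comp
    · intro l l' n m hl hm
      obtain ⟨⟨x, hx, e⟩, h2⟩ := (key _ _).1 hm
      refine (key _ _).2 ⟨⟨x, mF _ _ _ _ hl hx, e⟩, fun k hk => ?_⟩
      obtain ⟨y, hy, e'⟩ := h2 k hk
      exact ⟨y, mF _ _ _ _ hl hy, e'⟩
    · intro n m
      refine (key _ _).trans (Iff.trans ?_ (exists_congr fun l => (key _ _).symm))
      constructor
      · rintro ⟨⟨x, hx, e⟩, h2⟩
        obtain ⟨l, hl⟩ := (cF _ _).1 hx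
        have : ∃ L, ∀ k < m, ∃ a ∈ F (initSeg g L) (Nat.pair n k), decide (a = 0) = false := by
          have h3 : ∀ k, ∃ L, k < m →
              ∃ a ∈ F (initSeg g L) (Nat.pair n k), decide (a = 0) = false := by
            intro k
            by_cases hk : k < m
            · obtain ⟨a, ha, e'⟩ := h2 k hk
              obtain ⟨L, hL⟩ := (cF _ _).1 ha
              exact ⟨L, fun _ => ⟨a, hL, e'⟩⟩
            · exact ⟨0, fun h => absurd h hk⟩
          choose L hL using h3
          refine ⟨(Finset.range m).sup L, fun k hk => ?_⟩
          obtain ⟨a, ha, e'⟩ := hL k hk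
          exact ⟨a, mF _ _ _ _ (Finset.le_sup (Finset.mem_range.2 hk)) ha, e'⟩
        obtain ⟨L, hL⟩ := this
        refine ⟨max l L, ⟨x, mF _ _ _ _ (le_max_left _ _) hl, e⟩, fun k hk => ?_⟩
        obtain ⟨a, ha, e'⟩ := hL k hk
        exact ⟨a, mF _ _ _ _ (le_max_right _ _) ha, e'⟩
      · rintro ⟨l, ⟨x, hx, e⟩, h2⟩
        refine ⟨⟨x, (cF _ _).2 ⟨l, hx⟩, e⟩, fun k hk => ?_⟩
        obtain ⟨a, ha, e'⟩ := h2 k hk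
        exact ⟨a, (cF _ _).2 ⟨l, ha⟩, e'⟩


theorem Nat.RecursiveIn.comp_total {O : Set (ℕ →. ℕ)} {f : ℕ →. ℕ} {k : ℕ → ℕ}
    (hf : Nat.RecursiveIn O f) (hk : Nat.RecursiveIn O (k : ℕ →. ℕ)) :
    Nat.RecursiveIn O fun n => f (k n) :=
  (hf.comp hk).of_eq fun n => Part.bind_some (k n) f

theorem Nat.RecursiveIn.pair_total {O : Set (ℕ →. ℕ)} {f k : ℕ → ℕ}
    (hf : Nat.RecursiveIn O (f : ℕ →. ℕ)) (hk : Nat.RecursiveIn O (k : ℕ →. ℕ)) :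
    Nat.RecursiveIn O ((fun n => Nat.pair (f n) (k n) : ℕ → ℕ) : ℕ →. ℕ) :=
  (hf.pair hk).of_eq fun n => by simp [Seq.seq]

theorem recursiveIn_turingFunctional (e : ℕ) (g : ℕ → ℕ) :
    Nat.RecursiveIn {(g : ℕ →. ℕ)} (turingFunctional e g) := by
  have hprim : ∀ {f : ℕ → ℕ}, Primrec f → Nat.RecursiveIn {(g : ℕ →. ℕ)} (f : ℕ →. ℕ) :=
    fun hf => Nat.Primrec.recursiveIn (Primrec.nat_iff.1 hf)
  have horacle : Nat.RecursiveIn {(g : ℕ →. ℕ)} (g : ℕ →. ℕ) := .oracle _ rfl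
  have u1 : Primrec fun r : ℕ => r.unpair.1 := Primrec.fst.comp Primrec.unpair
  have u2 : Primrec fun r : ℕ => r.unpair.2 := Primrec.snd.comp Primrec.unpair
  have hseg : Nat.RecursiveIn {(g : ℕ →. ℕ)}
      ((fun l => Encodable.encode (initSeg g l) : ℕ → ℕ) : ℕ →. ℕ) := by
    have h2 : Primrec fun r : ℕ => Encodable.encode (((Encodable.decode r.unpair.1 :
        Option (List ℕ)).getD []) ++ [r.unpair.2]) :=
      Primrec.encode.comp (Primrec.list_concat.comp
        (Primrec.option_getD.comp (Primrec.decode.comp u1) (Primrec.const [])) u2)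
    have hg : Nat.RecursiveIn {(g : ℕ →. ℕ)}
        ((fun q => g q.unpair.2.unpair.1 : ℕ → ℕ) : ℕ →. ℕ) :=
      horacle.comp_total (k := fun q => q.unpair.2.unpair.1) (hprim (u1.comp u2))
    have step := (hprim h2).comp_total ((hprim (u2.comp u2)).pair_total hg)
    have hz : Nat.RecursiveIn {(g : ℕ →. ℕ)} ((fun _ => 0 : ℕ → ℕ) : ℕ →. ℕ) := .zero
    have hp := hprim (Primrec₂.natPair.comp (Primrec.const 0) Primrec.id)
    refine ((Nat.RecursiveIn.prec hz step).comp_total hp).of_eq fun l => ?_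
    simp only [PFun.coe_val, Part.bind_eq_bind, Nat.unpair_pair, id]
    induction l with
    | zero => rfl
    | succ l ih =>
      simp only [ih, Part.bind_some]
      simp [initSeg, List.range_succ]
  let t : ℕ → ℕ → Option ℕ := fun n k => Nat.Partrec.Code.evaln k.unpair.2
    (Denumerable.ofNat Nat.Partrec.Code e) (Nat.pair (Encodable.encode (initSeg g k.unpair.1)) n)
  have h2 : Primrec fun r : ℕ => Encodable.encode
      (Nat.Partrec.Code.evaln r.unpair.2.unpair.2.unpair.2 (Denumerable.ofNat Nat.Partrec.Code e)
        (Nat.pair r.unpair.1 r.unpair.2.unpair.1)) :=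
    Primrec.encode.comp (Nat.Partrec.Code.primrec_evaln.comp
      (((u2.comp (u2.comp u2)).pair (Primrec.const _)).pair
        (Primrec₂.natPair.comp u1 (u1.comp u2))))
  have htest : Nat.RecursiveIn {(g : ℕ →. ℕ)}
      ((fun p => Encodable.encode (t p.unpair.1 p.unpair.2) : ℕ → ℕ) : ℕ →. ℕ) := by
    refine ((hprim h2).comp_total
      ((hseg.comp_total (hprim (u1.comp u2))).pair_total (hprim Primrec.id))).of_eq fun p => ?_
    simp [t]
  have hbad : Primrec fun x : ℕ => if x = 0 then 1 else 0 :=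
    Primrec.ite (Primrec.eq.comp Primrec.id (Primrec.const 0)) (Primrec.const 1) (Primrec.const 0)
  have hfind := Nat.RecursiveIn.rfind ((hprim hbad).comp_total htest)
  have hfind' : Nat.RecursiveIn {(g : ℕ →. ℕ)}
      fun n => Nat.rfind fun k => ((t n k).isSome : Part Bool) := by
    refine hfind.of_eq fun n => ?_
    congr 1
    funext k
    simp only [PFun.coe_val, Nat.unpair_pair, Part.map_eq_map, Part.map_some]
    cases t n k <;> simp
  have hval : Nat.RecursiveIn {(g : ℕ →. ℕ)}
      ((fun p => Encodable.encode (t p.unpair.1 p.unpair.2) - 1 : ℕ → ℕ) : ℕ →. ℕ) :=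
    (hprim Primrec.pred).comp_total htest
  refine (hval.comp ((hprim Primrec.id).pair hfind')).of_eq fun n => Part.ext fun m => ?_
  have hpair : ∀ (a b : Part ℕ) m, m ∈ (Nat.pair <$> a <*> b) ↔
      ∃ x ∈ a, ∃ y ∈ b, Nat.pair x y = m := by
    intro a b m
    simp [Seq.seq, eq_comm]
  refine Part.mem_bind_iff.trans (Iff.trans ?_ Part.mem_bind_iff.symm)
  constructor
  · rintro ⟨q, hq, hm⟩
    obtain ⟨x, hx, k, hk, rfl⟩ := (hpair _ _ _).1 hq
    obtain rfl : x = n := by simpa using hx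
    refine ⟨k, hk, ?_⟩
    obtain ⟨v, hv⟩ := Option.isSome_iff_exists.1 (by simpa using Nat.rfind_spec hk)
    change m ∈ ((t x k : Option ℕ) : Part ℕ)
    rw [hv]
    simpa [hv] using hm
  · rintro ⟨k, hk, hm⟩
    refine ⟨Nat.pair n k, (hpair _ _ _).2 ⟨n, by simp, k, hk, rfl⟩, ?_⟩
    have hm' : t n k = some m := by simpa using hm
    simp [hm']

/-- The functionals `Φ_e` enumerate exactly the functions that are partial recursive in the
oracle. -/
theorem recursiveIn_iff_turingFunctional {g : ℕ → ℕ} {h : ℕ →. ℕ} :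
    TuringReducible h (g : ℕ →. ℕ) ↔ ∃ e, turingFunctional e g = h := by
  refine RecursiveIn.iff_nat.trans ⟨fun H => ?_, ?_⟩
  · obtain ⟨F, hF, mF, cF⟩ := ApproxFrom.exists_of_recursiveIn H
    obtain ⟨c, hc⟩ := Nat.Partrec.Code.exists_code.1 hF
    have hc' : ∀ σ n, c.eval (Nat.pair (Encodable.encode σ) n) = F σ n := by
      intro σ n
      have := congrFun hc (Nat.pair (Encodable.encode σ) n)
      rw [this]
      have hd : (Encodable.decode (Nat.pair (Encodable.encode σ) n) : Option (List ℕ × ℕ)) =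
          some (σ, n) := Encodable.encodek (σ, n)
      rw [hd]
      simp only [Part.coe_some, Part.bind_some]
      exact Part.map_id' (fun _ => rfl) _
    refine ⟨Encodable.encode c, funext fun n => Part.ext fun m => ?_⟩
    have sound : ∀ m', m' ∈ turingFunctional (Encodable.encode c) g n → m' ∈ h n := by
      intro m' hm
      obtain ⟨k, hk⟩ := Nat.rfindOpt_spec hm
      rw [Denumerable.ofNat_encode] at hk
      exact (cF _ _).2 ⟨_, (hc' _ _) ▸ Nat.Partrec.Code.evaln_sound hk⟩
    refine ⟨sound m, fun hm => ?_⟩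
    obtain ⟨l, hl⟩ := (cF _ _).1 hm
    rw [← hc', Nat.Partrec.Code.evaln_complete] at hl
    obtain ⟨s, hs⟩ := hl
    have hdom : (turingFunctional (Encodable.encode c) g n).Dom :=
      Nat.rfindOpt_dom.2 ⟨Nat.pair l s, m, by simpa [Denumerable.ofNat_encode] using hs⟩
    have := sound _ (Part.get_mem hdom)
    rw [Part.mem_unique hm this]
    exact Part.get_mem hdom
  · rintro ⟨e, rfl⟩
    exact recursiveIn_turingFunctional e g

/-! ### Effectively closed subsets of Cantor space -/

/-- Cantor space, as a subset of Baire space. -/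
def cantorSpace : Set (ℕ → ℕ) := {f | ∀ n, f n < 2}

/-- A tree: a set of finite strings closed under initial segments. -/
def IsTree (T : Set (List ℕ)) : Prop := ∀ σ τ : List ℕ, σ <+: τ → τ ∈ T → σ ∈ T

/-- The set `[T]` of infinite paths. -/
def paths (T : Set (List ℕ)) : Set (ℕ → ℕ) := {f | ∀ n, initSeg f n ∈ T}

/-- `P` is `Π⁰₁`: the set of infinite paths of a computable tree. -/
def IsPi01 (P : Set (ℕ → ℕ)) : Prop :=
  ∃ T : Set (List ℕ), IsTree T ∧ ComputablePred (fun σ => σ ∈ T) ∧ P = paths T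

/-- `P` is a `Π⁰₁` subset of Cantor space. -/
def IsPi01Cantor (P : Set (ℕ → ℕ)) : Prop := P ⊆ cantorSpace ∧ IsPi01 P

/-- `P` is special: nonempty, without computable member. -/
def IsSpecial (P : Set (ℕ → ℕ)) : Prop := P.Nonempty ∧ ∀ f ∈ P, ¬ Computable f

/-- The Turing upward closure of `P` (in Cantor space). -/
def turingUpwardClosure (P : Set (ℕ → ℕ)) : Set (ℕ → ℕ) :=
  {g | g ∈ cantorSpace ∧ ∃ f ∈ P, TuringLE f g}

/-! ### Learners -/

/-- The `e`-th learner `Ψ_e`, in the standard enumeration of all partial computable functions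
from finite strings to natural numbers. -/
def learner (e : ℕ) : List ℕ →. ℕ := fun σ =>
  (Denumerable.ofNat Nat.Partrec.Code e).eval (Encodable.encode σ)

/-- `lim_n Ψ_e(g ↾ n)` converges to `i`. -/
def LearnerTendsTo (e : ℕ) (g : ℕ → ℕ) (i : ℕ) : Prop :=
  ∃ N, ∀ n ≥ N, i ∈ learner e (initSeg g n)

/-- The partial function `Γ` is identified by the learner `Ψ_e` on `g`: the limit
`i = lim_n Ψ_e(g ↾ n)` converges and `Φ_i(g) = Γ(g)`. -/
def IdentifiedOn (e : ℕ) (Γ : (ℕ → ℕ) →. (ℕ → ℕ)) (g : ℕ → ℕ) : Prop :=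
  ∃ i, LearnerTendsTo e g i ∧ ∃ h ∈ Γ g, FunctionalEq i g h

/-! ### Classes of nonuniformly computable functions and their reducibilities -/

/-- `Γ` is `(<ω, ω)`-computable, i.e. learnable by a finite team of learners. -/
def TeamLearnable (Γ : (ℕ → ℕ) →. (ℕ → ℕ)) : Prop :=
  ∃ b : ℕ, ∀ g ∈ Γ.Dom, ∃ e < b, IdentifiedOn e Γ g

/-- `Γ` is `(ω, 1)`-computable, i.e. nonuniformly computable. -/
def NonuniformlyComputable (Γ : (ℕ → ℕ) →. (ℕ → ℕ)) : Prop :=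
  ∀ g, ∀ h ∈ Γ g, TuringLE h g

/-- `P ≤_𝓕 Q`: some partial function in `𝓕` is defined on all of `Q` and maps `Q` into `P`. -/
def ReducibleBy (𝓕 : ((ℕ → ℕ) →. (ℕ → ℕ)) → Prop) (P Q : Set (ℕ → ℕ)) : Prop :=
  ∃ Γ : (ℕ → ℕ) →. (ℕ → ℕ), 𝓕 Γ ∧ ∀ g ∈ Q, ∃ h ∈ Γ g, h ∈ P

/-- `P ≤^{<ω}_ω Q`. -/
def TeamReducible (P Q : Set (ℕ → ℕ)) : Prop := ReducibleBy TeamLearnable P Q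

/-- Muchnik reducibility `P ≤^ω_1 Q`. -/
def MuchnikReducible (P Q : Set (ℕ → ℕ)) : Prop := ReducibleBy NonuniformlyComputable P Q

/-- Muchnik equivalence `P ≡^ω_1 Q`. -/
def MuchnikEquiv (P Q : Set (ℕ → ℕ)) : Prop := MuchnikReducible P Q ∧ MuchnikReducible Q P

/-- The LEVEL 4 separation between the classes `𝓕` and `𝓖`: for every special `Π⁰₁` set `Y` there
is a `Π⁰₁` set `X` such that `𝓕` has a function from `X` to `Y`, but `𝓖` has none. -/
def Level4Separation (𝓕 𝓖 : ((ℕ → ℕ) →. (ℕ → ℕ)) → Prop) : Prop :=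
  ∀ Y : Set (ℕ → ℕ), IsPi01Cantor Y → IsSpecial Y →
    ∃ X : Set (ℕ → ℕ), IsPi01Cantor X ∧ ReducibleBy 𝓕 Y X ∧ ¬ ReducibleBy 𝓖 Y X

/-! All three parts come from one class `P'` with `P ⊆ P' ⊆` the Turing upward closure of `P` such
that no finite team maps `P'` into `Q` (`exists_not_teamReducible`).

The tree of `P'` is that of `P` with a tree of a class C(A, ρ) put on top of each leaf ρ of length
m, where A lists the learners below m. Two things are needed of C(A, σ): each member computes a
member of `P`, and some member h is such that every learner in A fails on σ⌢h. A team of b learners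
is then defeated above any leaf of length at least b; such leaves exist because `P` has no
computable member.

A member of C(A, σ) spells out a member of `P`, but it may write a bit only after every learner in A
has changed its mind since the previous bit. While e is the first learner that has not, the
sequence, being at a node s, must run along the tree of C(A∖{e}, s). It may leave that tree only at
the first leaf, in a fixed numbering, at which e has changed its mind or its hypothesis has produced
a longer string that is not rejected by the tree of `Q`. The class thus refers to itself, which the
recursion theorem permits (`exists_code_parse`).

Computing a member of `P` (`exists_turingLE_of_mem_effClass`): a member that stays in one block has
a tail in a class with a shorter list, so induction applies. If there are infinitely many blocks but
only finitely many bits, the sequence is eventually generated by a computable search, and along it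
one fixed hypothesis is confirmed further and further; this yields a computable member of `Q`
(`IsParse.code_unbounded`). In particular C(A, σ) has no computable member, so each node of its tree
lies below a leaf.

Failure (`exists_fails`): code a fixed f in `P`. If at some node no leaf shows progress of e, remain
in that block, along a member of C(A∖{e}, s) on which the other learners fail; e fails too, since
success would become visible at a leaf (`fails_of_not_isHit`). If no such node is met, all of f gets
coded, and every learner in A changes its mind infinitely often. -/

open Nat.Partrec (Code)
open Encodable

/-! ### Trees of binary strings presented by enumerations of their complements -/

/-- The string `τ` is binary, and the program `c` has not yet rejected any of its initial segments
(relative to the parameter `z`). -/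
def Alive (c : Code) (z : List ℕ × List ℕ) (τ : List ℕ) : Prop :=
  (∀ x ∈ τ, x < 2) ∧
    ∀ n < τ.length + 1, Code.evaln τ.length c (encode (z, τ.take n)) = none

/-- The `Π⁰₁` class of the sequences in Cantor space no initial segment of which is rejected. -/
def effClass (c : Code) (z : List ℕ × List ℕ) : Set (ℕ → ℕ) := {f | ∀ n, Alive c z (initSeg f n)}

/-- A minimal binary string that has been rejected. -/
def IsLeaf (c : Code) (z : List ℕ × List ℕ) (ρ : List ℕ) : Prop :=
  (∀ x ∈ ρ, x < 2) ∧ ¬ Alive c z ρ ∧ Alive c z (ρ.take (ρ.length - 1))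

/-- A total version of the learner `Ψ_e`, with the same limits. -/
def totalLearner (e : ℕ) (σ : List ℕ) : ℕ :=
  (List.range (σ.length + 1)).foldl
    (fun r m => (Code.evaln σ.length (Denumerable.ofNat Code e) (encode (σ.take m))).getD r) 0

/-- The stages of the computation of `Φ_i(g; n)` for `g` extending `σ`. -/
def functionalStage (i : ℕ) (σ : List ℕ) (n k : ℕ) : Option ℕ :=
  Code.evaln k.unpair.2 (Denumerable.ofNat Code i) (Nat.pair (encode (σ.take k.unpair.1)) n)

/-- The value of `Φ_i(g; n)` if it is found from the initial segment `σ` of `g`. -/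
def functionalApprox (i : ℕ) (σ : List ℕ) (n : ℕ) : Option ℕ :=
  (List.range (σ.length + 1)).foldl (fun r k => r <|> functionalStage i σ n k) none

/-- From `σ` the first `l` values of `Φ_i` are found, and `q` has not rejected them. -/
def Agrees (q : Code) (i : ℕ) (σ : List ℕ) (l : ℕ) : Prop :=
  l ≤ σ.length ∧ (∀ n < l, (functionalApprox i σ n).isSome) ∧
    Alive q ([], []) ((List.range l).map fun n => (functionalApprox i σ n).getD 0)

/-- The learner `e` changes its mind between `p` and its extension `s`. -/
def MindChange (e : ℕ) (p s : List ℕ) : Prop :=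
  ∃ n < s.length + 1, p.length ≤ n ∧ totalLearner e (s.take n) ≠ totalLearner e p

/-- Between `s` and `s'` the hypothesis that `e` makes at `p` is confirmed further, unless it is
given up. -/
def Progress (q : Code) (e : ℕ) (p s s' : List ℕ) : Prop :=
  MindChange e p s' ∨
    ∃ l < s'.length + 1, Agrees q (totalLearner e p) s' l ∧ ¬ Agrees q (totalLearner e p) s l

/-- `ρ` is a leaf, relative to the parameter `(A, s)`, at which `e` makes progress. -/
def IsHit (q c : Code) (A : List ℕ) (e : ℕ) (p s ρ : List ℕ) : Prop :=
  IsLeaf c (A, s) ρ ∧ Progress q e p s (s ++ ρ)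

/-- `ρ` is the first leaf at which `e` makes progress. -/
def IsFirstHit (q c : Code) (A : List ℕ) (e : ℕ) (p s ρ : List ℕ) : Prop :=
  IsHit q c A e p s ρ ∧ ∀ n < encode ρ, ¬ IsHit q c A e p s (Denumerable.ofNat (List ℕ) n)

open Classical in
/-- The first learner in the list `A` that does not change its mind between `p` and `s`. -/
noncomputable def firstStable (A p s : List ℕ) : Option ℕ :=
  (A.filter fun e => ¬ MindChange e p s).head?

/-- The states of the parser: the position of the last coded bit, the position of the last block,
the coded string, the current block. -/
abbrev ParseState := List ℕ × List ℕ × List ℕ × List ℕ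

open Classical in
/-- The parser reads one more bit. -/
noncomputable def parseStep (p q c : Code) (A : List ℕ) (S : ParseState) (x : ℕ) :
    Option ParseState :=
  Option.casesOn (firstStable A S.1 S.2.1)
    (if Alive p ([], []) (S.2.2.1 ++ [x]) then
      some (S.2.1 ++ [x], S.2.1 ++ [x], S.2.2.1 ++ [x], []) else none)
    fun e =>
      if Alive c (A.filter (· ≠ e), S.2.1) (S.2.2.2 ++ [x]) then
        some (S.1, S.2.1, S.2.2.1, S.2.2.2 ++ [x])
      else if IsFirstHit q c (A.filter (· ≠ e)) e S.1 S.2.1 (S.2.2.2 ++ [x]) then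
        some (S.1, S.2.1 ++ (S.2.2.2 ++ [x]), S.2.2.1, [])
      else none

/-- The parser reads the string `τ` after `σ`. -/
noncomputable def parse (p q c : Code) (z : List ℕ × List ℕ) (τ : List ℕ) : Option ParseState :=
  τ.foldl (fun o x => o.bind fun S => parseStep p q c z.1 S x) (some (z.2, z.2, [], []))

/-! ### Primitive recursiveness -/

section Primrec

variable {α : Type*} [Primcodable α]

theorem PrimrecPred.forall_lt_of {R : ℕ → α → Prop} (hR : PrimrecPred fun x : ℕ × α => R x.1 x.2)
    {f : α → ℕ} (hf : Primrec f) : PrimrecPred fun a => ∀ n < f a, R n a :=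
  ((PrimrecRel.forall_mem_list (R := R) hR).comp (Primrec.list_range.comp hf) Primrec.id).of_eq
    fun a => by simp

theorem PrimrecPred.exists_lt_of {R : ℕ → α → Prop} (hR : PrimrecPred fun x : ℕ × α => R x.1 x.2)
    {f : α → ℕ} (hf : Primrec f) : PrimrecPred fun a => ∃ n < f a, R n a :=
  ((PrimrecRel.exists_mem_list (R := R) hR).comp (Primrec.list_range.comp hf) Primrec.id).of_eq
    fun a => by simp

theorem Primrec.evaln_of {f : α → ℕ} {c : α → Code} {g : α → ℕ} (hf : Primrec f) (hc : Primrec c)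
    (hg : Primrec g) : Primrec fun a => Code.evaln (f a) (c a) (g a) :=
  Code.primrec_evaln.comp ((hf.pair hc).pair hg)

theorem primrecPred_isSome {f : α → Option ℕ} (hf : Primrec f) :
    PrimrecPred fun a => (f a).isSome = true :=
  Primrec.eq.comp (Primrec.option_isSome.comp hf) (Primrec.const true)

theorem primrecPred_binary {t : α → List ℕ} (ht : Primrec t) :
    PrimrecPred fun a => ∀ x ∈ t a, x < 2 :=
  (PrimrecPred.forall_mem_list (p := fun x : ℕ => x < 2)
    (Primrec.nat_lt.comp Primrec.id (Primrec.const 2))).comp ht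

theorem primrecPred_alive {c : α → Code} {z : α → List ℕ × List ℕ} {t : α → List ℕ}
    (hc : Primrec c) (hz : Primrec z) (ht : Primrec t) :
    PrimrecPred fun a => Alive (c a) (z a) (t a) := by
  refine PrimrecPred.and (primrecPred_binary ht) ?_
  refine PrimrecPred.forall_lt_of (R := fun n a => Code.evaln (t a).length (c a)
    (encode (z a, (t a).take n)) = none) ?_ (Primrec.succ.comp (Primrec.list_length.comp ht))
  refine Primrec.eq.comp (Primrec.evaln_of (Primrec.list_length.comp (ht.comp Primrec.snd))
    (hc.comp Primrec.snd) (Primrec.encode.comp ((hz.comp Primrec.snd).pair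
      (Primrec.list_take.comp Primrec.fst (ht.comp Primrec.snd))))) (Primrec.const none)

theorem primrecPred_isLeaf {c : α → Code} {z : α → List ℕ × List ℕ} {t : α → List ℕ}
    (hc : Primrec c) (hz : Primrec z) (ht : Primrec t) :
    PrimrecPred fun a => IsLeaf (c a) (z a) (t a) :=
  (primrecPred_binary ht).and ((primrecPred_alive hc hz ht).not.and
    (primrecPred_alive hc hz (Primrec.list_take.comp
      (Primrec.nat_sub.comp (Primrec.list_length.comp ht) (Primrec.const 1)) ht)))

theorem primrec_totalLearner {e : α → ℕ} {t : α → List ℕ} (he : Primrec e) (ht : Primrec t) :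
    Primrec fun a => totalLearner (e a) (t a) := by
  refine Primrec.list_foldl (h := fun a (x : ℕ × ℕ) =>
    (Code.evaln (t a).length (Denumerable.ofNat Code (e a)) (encode ((t a).take x.2))).getD x.1)
    (Primrec.list_range.comp (Primrec.succ.comp (Primrec.list_length.comp ht)))
    (Primrec.const 0) ?_
  refine Primrec.option_getD.comp (Primrec.evaln_of (Primrec.list_length.comp (ht.comp Primrec.fst))
    ((Primrec.ofNat Code).comp (he.comp Primrec.fst)) (Primrec.encode.comp
      (Primrec.list_take.comp (Primrec.snd.comp Primrec.snd) (ht.comp Primrec.fst))))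
    (Primrec.fst.comp Primrec.snd)

theorem primrec_functionalApprox {i : α → ℕ} {t : α → List ℕ} {n : α → ℕ} (hi : Primrec i)
    (ht : Primrec t) (hn : Primrec n) : Primrec fun a => functionalApprox (i a) (t a) (n a) := by
  refine Primrec.list_foldl (h := fun a (x : Option ℕ × ℕ) =>
    (x.1 <|> functionalStage (i a) (t a) (n a) x.2))
    (Primrec.list_range.comp (Primrec.succ.comp (Primrec.list_length.comp ht)))
    (Primrec.const none) ?_
  have hk : Primrec fun y : α × (Option ℕ × ℕ) => y.2.2.unpair :=
    Primrec.unpair.comp (Primrec.snd.comp Primrec.snd)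
  refine Primrec.option_orElse.comp (Primrec.fst.comp Primrec.snd)
    (Primrec.evaln_of (Primrec.snd.comp hk) ((Primrec.ofNat Code).comp (hi.comp Primrec.fst))
      (Primrec₂.natPair.comp (Primrec.encode.comp (Primrec.list_take.comp (Primrec.fst.comp hk)
        (ht.comp Primrec.fst))) (hn.comp Primrec.fst)))

theorem primrecPred_agrees {q : Code} {i : α → ℕ} {t : α → List ℕ} {l : α → ℕ} (hi : Primrec i)
    (ht : Primrec t) (hl : Primrec l) : PrimrecPred fun a => Agrees q (i a) (t a) (l a) := by
  refine (Primrec.nat_le.comp hl (Primrec.list_length.comp ht)).and (PrimrecPred.and ?_ ?_)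
  · exact PrimrecPred.forall_lt_of (R := fun n a => (functionalApprox (i a) (t a) n).isSome = true)
      (primrecPred_isSome (primrec_functionalApprox (hi.comp Primrec.snd) (ht.comp Primrec.snd)
        Primrec.fst)) hl
  · refine primrecPred_alive (Primrec.const q) (Primrec.const ([], [])) ?_
    exact Primrec.list_map (Primrec.list_range.comp hl) (Primrec.option_getD.comp
      (primrec_functionalApprox (hi.comp Primrec.fst) (ht.comp Primrec.fst) Primrec.snd)
      (Primrec.const 0))

theorem primrecPred_mindChange {e : α → ℕ} {p s : α → List ℕ} (he : Primrec e) (hp : Primrec p)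
    (hs : Primrec s) : PrimrecPred fun a => MindChange (e a) (p a) (s a) := by
  refine PrimrecPred.exists_lt_of (R := fun n a => (p a).length ≤ n ∧
    totalLearner (e a) ((s a).take n) ≠ totalLearner (e a) (p a)) ?_
    (Primrec.succ.comp (Primrec.list_length.comp hs))
  refine (Primrec.nat_le.comp (Primrec.list_length.comp (hp.comp Primrec.snd)) Primrec.fst).and
    (Primrec.eq.comp (primrec_totalLearner (he.comp Primrec.snd)
      (Primrec.list_take.comp Primrec.fst (hs.comp Primrec.snd)))
      (primrec_totalLearner (he.comp Primrec.snd) (hp.comp Primrec.snd))).not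

theorem primrecPred_progress {q : Code} {e : α → ℕ} {p s s' : α → List ℕ} (he : Primrec e)
    (hp : Primrec p) (hs : Primrec s) (hs' : Primrec s') :
    PrimrecPred fun a => Progress q (e a) (p a) (s a) (s' a) := by
  refine (primrecPred_mindChange he hp hs').or ?_
  refine PrimrecPred.exists_lt_of (R := fun l a => Agrees q (totalLearner (e a) (p a)) (s' a) l ∧
    ¬ Agrees q (totalLearner (e a) (p a)) (s a) l) ?_
    (Primrec.succ.comp (Primrec.list_length.comp hs'))
  have hL := (primrec_totalLearner he hp).comp (Primrec.snd (α := ℕ))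
  exact (primrecPred_agrees hL (hs'.comp Primrec.snd) Primrec.fst).and
    (primrecPred_agrees hL (hs.comp Primrec.snd) Primrec.fst).not

theorem primrecPred_isHit {q : Code} {c : α → Code} {A : α → List ℕ} {e : α → ℕ}
    {p s r : α → List ℕ} (hc : Primrec c) (hA : Primrec A) (he : Primrec e) (hp : Primrec p)
    (hs : Primrec s) (hr : Primrec r) :
    PrimrecPred fun a => IsHit q (c a) (A a) (e a) (p a) (s a) (r a) :=
  (primrecPred_isLeaf hc (hA.pair hs) hr).and
    (primrecPred_progress he hp hs (Primrec.list_append.comp hs hr))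

theorem primrecPred_isFirstHit {q : Code} {c : α → Code} {A : α → List ℕ} {e : α → ℕ}
    {p s r : α → List ℕ} (hc : Primrec c) (hA : Primrec A) (he : Primrec e) (hp : Primrec p)
    (hs : Primrec s) (hr : Primrec r) :
    PrimrecPred fun a => IsFirstHit q (c a) (A a) (e a) (p a) (s a) (r a) := by
  refine (primrecPred_isHit hc hA he hp hs hr).and ?_
  refine PrimrecPred.forall_lt_of (R := fun n a => ¬ IsHit q (c a) (A a) (e a) (p a) (s a)
    (Denumerable.ofNat (List ℕ) n)) ?_ (Primrec.encode.comp hr)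
  exact (primrecPred_isHit (hc.comp Primrec.snd) (hA.comp Primrec.snd) (he.comp Primrec.snd)
    (hp.comp Primrec.snd) (hs.comp Primrec.snd) ((Primrec.ofNat (List ℕ)).comp Primrec.fst)).not

theorem primrec_firstStable {A p s : α → List ℕ} (hA : Primrec A) (hp : Primrec p)
    (hs : Primrec s) : Primrec fun a => firstStable (A a) (p a) (s a) := by
  classical
  have hR : PrimrecRel fun (e : ℕ) (x : List ℕ × List ℕ) => ¬ MindChange e x.1 x.2 :=
    (primrecPred_mindChange Primrec.fst (Primrec.fst.comp Primrec.snd)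
      (Primrec.snd.comp Primrec.snd)).not
  refine (Primrec.list_head?.comp ((PrimrecRel.listFilter hR).comp hA (hp.pair hs))).of_eq
    fun a => ?_
  unfold firstStable
  congr!

theorem primrec_filter_ne {A : α → List ℕ} {e : α → ℕ} (hA : Primrec A) (he : Primrec e) :
    Primrec fun a => (A a).filter (· ≠ e a) := by
  have hR : PrimrecRel fun (x e : ℕ) => x ≠ e := (Primrec.eq (α := ℕ)).not
  exact (PrimrecRel.listFilter hR).comp hA he

theorem primrec_parseStep {p q : Code} {c : α → Code} {A : α → List ℕ} {S : α → ParseState}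
    {x : α → ℕ} (hc : Primrec c) (hA : Primrec A) (hS : Primrec S) (hx : Primrec x) :
    Primrec fun a => parseStep p q (c a) (A a) (S a) (x a) := by
  classical
  have h1 := Primrec.fst.comp hS
  have h2 := Primrec.fst.comp (Primrec.snd.comp hS)
  have h3 := Primrec.fst.comp (Primrec.snd.comp (Primrec.snd.comp hS))
  have h4 := Primrec.snd.comp (Primrec.snd.comp (Primrec.snd.comp hS))
  have h3x := Primrec.list_concat.comp h3 hx
  have h2x := Primrec.list_concat.comp h2 hx
  have h4x := (Primrec.list_concat.comp h4 hx).comp (Primrec.fst (β := ℕ))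
  have hA' := primrec_filter_ne (hA.comp (Primrec.fst (β := ℕ))) Primrec.snd
  refine Primrec.option_casesOn (primrec_firstStable hA h1 h2) ?_ ?_
  · exact Primrec.ite (primrecPred_alive (Primrec.const p) (Primrec.const ([], [])) h3x)
      (Primrec.option_some.comp (h2x.pair (h2x.pair (h3x.pair (Primrec.const [])))))
      (Primrec.const none)
  · refine Primrec.ite (primrecPred_alive (hc.comp Primrec.fst) (hA'.pair (h2.comp Primrec.fst))
      h4x) (Primrec.option_some.comp ((h1.comp Primrec.fst).pair ((h2.comp Primrec.fst).pair
        ((h3.comp Primrec.fst).pair h4x)))) (Primrec.ite ?_ ?_ (Primrec.const none))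
    · exact primrecPred_isFirstHit (hc.comp Primrec.fst) hA' Primrec.snd (h1.comp Primrec.fst)
        (h2.comp Primrec.fst) h4x
    · exact Primrec.option_some.comp ((h1.comp Primrec.fst).pair ((Primrec.list_append.comp
        (h2.comp Primrec.fst) h4x).pair ((h3.comp Primrec.fst).pair (Primrec.const []))))

/-- Uniformity in `c` is what the recursion theorem requires. Each call of `c` is cut off after as
many steps as the tested string is long, so the parser always halts, even on its own program. -/
theorem primrec_parse {p q : Code} {c : α → Code} {z : α → List ℕ × List ℕ} {t : α → List ℕ}
    (hc : Primrec c) (hz : Primrec z) (ht : Primrec t) :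
    Primrec fun a => parse p q (c a) (z a) (t a) := by
  have hz2 := Primrec.snd.comp hz
  refine Primrec.list_foldl (h := fun a (y : Option ParseState × ℕ) =>
    y.1.bind fun S => parseStep p q (c a) (z a).1 S y.2) ht
    (Primrec.option_some.comp (hz2.pair (hz2.pair (Primrec.const ([], []))))) ?_
  refine Primrec.option_bind (Primrec.fst.comp Primrec.snd) ?_
  exact primrec_parseStep (hc.comp (Primrec.fst.comp Primrec.fst))
    (Primrec.fst.comp (hz.comp (Primrec.fst.comp Primrec.fst))) Primrec.snd
    (Primrec.snd.comp (Primrec.snd.comp Primrec.fst))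

end Primrec

/-- By the recursion theorem, there is a program that rejects the strings rejected by the parser
that uses this very program. -/
theorem exists_code_parse (p q : Code) : ∃ c : Code, ∀ z τ,
    (Code.eval c (encode (z, τ))).Dom ↔ parse p q c z τ = none := by
  -- Rejecting means halting, here with the irrelevant value 0; on accepted strings the program
  -- diverges.
  let f : Code → ℕ → Option ℕ := fun c n =>
    (decode (α := (List ℕ × List ℕ) × List ℕ) n).bind fun y =>
      Option.casesOn (parse p q c y.1 y.2) (some 0) fun _ => none
  have hf : Computable₂ f := by
    refine (Primrec.option_bind (f := fun x : Code × ℕ =>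
      decode (α := (List ℕ × List ℕ) × List ℕ) x.2) (Primrec.decode.comp Primrec.snd) ?_).to_comp
    exact Primrec.option_casesOn (primrec_parse (Primrec.fst.comp Primrec.fst)
      (Primrec.fst.comp Primrec.snd) (Primrec.snd.comp Primrec.snd)) (Primrec.const (some 0))
      (Primrec.const none).to₂
  obtain ⟨c, hc⟩ := Code.fixed_point₂ (f := fun c n => (f c n : Part ℕ)) (Computable.ofOption hf)
  refine ⟨c, fun z τ => ?_⟩
  rw [hc]
  simp only [f, encodek, Option.bind_some]
  cases parse p q c z τ <;> simp

/-! ### Initial segments -/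

theorem initSeg_length (f : ℕ → ℕ) (n : ℕ) : (initSeg f n).length = n := by simp [initSeg]

theorem initSeg_succ (f : ℕ → ℕ) (n : ℕ) : initSeg f (n + 1) = initSeg f n ++ [f n] := by
  simp [initSeg, List.range_succ]

theorem initSeg_take (f : ℕ → ℕ) {m n : ℕ} (h : m ≤ n) : (initSeg f n).take m = initSeg f m := by
  simp [initSeg, ← List.map_take, List.take_range, min_eq_left h]

theorem initSeg_prefix (f : ℕ → ℕ) {m n : ℕ} (h : m ≤ n) : initSeg f m <+: initSeg f n := by
  rw [← initSeg_take f h]; exact List.take_prefix _ _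

theorem mem_initSeg {f : ℕ → ℕ} {n x : ℕ} : x ∈ initSeg f n ↔ ∃ m < n, f m = x := by
  simp [initSeg]

/-- The sequence `σ⌢h`. -/
def prepend (σ : List ℕ) (h : ℕ → ℕ) : ℕ → ℕ := fun n => σ.getD n (h (n - σ.length))

theorem initSeg_prepend (σ : List ℕ) (h : ℕ → ℕ) (n : ℕ) :
    initSeg (prepend σ h) (σ.length + n) = σ ++ initSeg h n := by
  induction n with
  | zero =>
    refine List.ext_getElem (by simp [initSeg]) fun i h1 h2 => ?_
    have : i < σ.length := by simpa [initSeg] using h1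
    simp [initSeg, prepend, this]
  | succ n ih => rw [← add_assoc, initSeg_succ, ih, initSeg_succ]; simp [prepend]

theorem initSeg_drop (h : ℕ → ℕ) (m n : ℕ) :
    (initSeg h (m + n)).drop m = initSeg (fun k => h (k + m)) n := by
  refine List.ext_getElem (by simp [initSeg]) fun i h1 h2 => ?_
  simp [initSeg, add_comm]

/-! ### Turing reducibility -/

/-- `F` need not be monotone along `g`: whichever value the dovetailed search meets first is correct
by `sound`. -/
theorem TuringLE.of_approx {f g : ℕ → ℕ} {F : List ℕ → ℕ → Option ℕ} (hF : Computable₂ F)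
    (sound : ∀ l n v, F (initSeg g l) n = some v → f n = v)
    (total : ∀ n, ∃ l, (F (initSeg g l) n).isSome) : TuringLE f g := by
  obtain ⟨c, hc⟩ := Code.exists_code.1 (Computable.ofOption hF)
  have hc' : ∀ σ n, c.eval (Nat.pair (encode σ) n) = (F σ n : Part ℕ) := by
    intro σ n
    have := congrFun hc (Nat.pair (encode σ) n)
    rw [this]
    have hd : (decode (Nat.pair (encode σ) n) : Option (List ℕ × ℕ)) = some (σ, n) :=
      encodek (σ, n)
    rw [hd]
    simp only [Part.coe_some, Part.bind_some]
    exact Part.map_id' (fun _ => rfl) _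
  refine recursiveIn_iff_turingFunctional.2 ⟨encode c, funext fun n => ?_⟩
  have hs : ∀ v, v ∈ turingFunctional (encode c) g n → f n = v := by
    intro v hv
    obtain ⟨k, hk⟩ := Nat.rfindOpt_spec hv
    rw [Denumerable.ofNat_encode] at hk
    refine sound k.unpair.1 n v ?_
    have := Code.evaln_sound hk
    rw [hc'] at this
    simpa using this
  obtain ⟨l, hl⟩ := total n
  obtain ⟨v, hv⟩ := Option.isSome_iff_exists.1 hl
  obtain ⟨s, hs'⟩ := Code.evaln_complete.1 (show v ∈ c.eval (Nat.pair (encode (initSeg g l)) n) by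
    rw [hc', hv]; simp)
  have hdom : (turingFunctional (encode c) g n).Dom :=
    Nat.rfindOpt_dom.2 ⟨Nat.pair l s, v, by simpa [Denumerable.ofNat_encode] using hs'⟩
  have h1 := hs _ (Part.get_mem hdom)
  exact (Part.get_eq_iff_eq_some.1 h1.symm)

theorem TuringLE.computable {f g : ℕ → ℕ} (h : TuringLE f g) (hg : Computable g) :
    Computable f := by
  have : Partrec (f : ℕ →. ℕ) := RecursiveIn.partrec_of_oracle (by rintro _ rfl; exact hg) h
  exact this

theorem TuringLE.rfl' (f : ℕ → ℕ) : TuringLE f f := TuringReducible.refl _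

theorem TuringLE.trans' {f g h : ℕ → ℕ} (h₁ : TuringLE f g) (h₂ : TuringLE g h) : TuringLE f h :=
  TuringReducible.trans h₁ h₂

theorem turingLE_shift (h : ℕ → ℕ) (m : ℕ) : TuringLE (fun k => h (k + m)) h := by
  refine TuringLE.of_approx (F := fun σ k => σ[k + m]?) ?_ ?_ ?_
  · exact (Primrec.list_getElem?.comp Primrec.fst
      (Primrec.nat_add.comp Primrec.snd (Primrec.const m))).to_comp
  · intro l n v hv
    exact ((initSeg_getElem? h l (n + m) v).1 hv).2
  · intro n
    refine ⟨n + m + 1, Option.isSome_iff_exists.2 ⟨h (n + m), ?_⟩⟩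
    exact (initSeg_getElem? h _ (n + m) _).2 ⟨by omega, rfl⟩

/-! ### Effectively closed classes -/

theorem evaln_eq_none_of_le {c : Code} {k k' n : ℕ} (h : k ≤ k') (H : Code.evaln k' c n = none) :
    Code.evaln k c n = none := by
  by_contra hne
  obtain ⟨v, hv⟩ := Option.ne_none_iff_exists'.1 hne
  have := Code.evaln_mono h (Option.mem_def.2 hv)
  rw [H] at this
  simp at this

theorem Alive.nil (c : Code) (z : List ℕ × List ℕ) : Alive c z [] := by
  simp [Alive, Code.evaln]

theorem Alive.of_prefix {c : Code} {z : List ℕ × List ℕ} {σ τ : List ℕ} (h : Alive c z τ)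
    (hp : σ <+: τ) : Alive c z σ := by
  refine ⟨fun x hx => h.1 x (hp.subset hx), fun n hn => ?_⟩
  have hl := hp.length_le
  have := evaln_eq_none_of_le hl (h.2 n (by omega))
  obtain ⟨t, rfl⟩ := hp
  rwa [List.take_append_of_le_length (by omega)] at this

/-- The step bound in `Alive` disappears in the limit: a halting computation on an initial segment
is noticed at every sufficiently long one. -/
theorem mem_effClass_iff {c : Code} {z : List ℕ × List ℕ} {f : ℕ → ℕ} :
    f ∈ effClass c z ↔
      f ∈ cantorSpace ∧ ∀ n, ¬ (Code.eval c (encode (z, initSeg f n))).Dom := by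
  constructor
  · intro h
    refine ⟨fun n => (h (n + 1)).1 _ (mem_initSeg.2 ⟨n, by omega, rfl⟩), fun n hd => ?_⟩
    obtain ⟨k, hk⟩ := Code.evaln_complete.1 (Part.get_mem hd)
    have h2 := (h (max k n)).2 n (by rw [initSeg_length]; omega)
    rw [initSeg_length, initSeg_take f (le_max_right k n)] at h2
    have := Code.evaln_mono (le_max_left k n) hk
    rw [h2] at this
    simp at this
  · rintro ⟨h1, h2⟩ n
    refine ⟨fun x hx => ?_, fun m hm => ?_⟩
    · obtain ⟨m, -, rfl⟩ := mem_initSeg.1 hx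
      exact h1 m
    · rw [initSeg_length] at hm ⊢
      rw [initSeg_take f (by omega)]
      by_contra hne
      obtain ⟨v, hv⟩ := Option.ne_none_iff_exists'.1 hne
      exact h2 m (Part.dom_iff_mem.2 ⟨v, Code.evaln_sound hv⟩)

theorem effClass_subset_cantorSpace (c : Code) (z : List ℕ × List ℕ) :
    effClass c z ⊆ cantorSpace := fun _ h => (mem_effClass_iff.1 h).1

theorem IsPi01Cantor.exists_code {P : Set (ℕ → ℕ)} (hP : IsPi01Cantor P) :
    ∃ p, P = effClass p ([], []) := by
  classical
  obtain ⟨hc, T, -, hT, rfl⟩ := hP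
  obtain ⟨hdec, hT⟩ := hT
  have hD : Computable fun n : ℕ => (decode (α := (List ℕ × List ℕ) × List ℕ) n).bind
      fun y => cond (decide (y.2 ∈ T)) none (some 0) := by
    refine Computable.option_bind Computable.decode ?_
    exact Computable.cond ((hT.comp Computable.snd).comp Computable.snd)
      (Computable.const none) (Computable.const (some 0))
  obtain ⟨p, hp⟩ := Code.exists_code.1 (Partrec.nat_iff.1 (Computable.ofOption hD))
  refine ⟨p, Set.ext fun f => ?_⟩
  rw [mem_effClass_iff]
  have key : ∀ n, (Code.eval p (encode ((([], []) : List ℕ × List ℕ), initSeg f n))).Dom ↔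
      initSeg f n ∉ T := by
    intro n
    rw [hp]
    simp only [encodek, Option.bind_some]
    by_cases h : initSeg f n ∈ T <;> simp [h]
  simp only [key, not_not]
  exact ⟨fun h => ⟨hc h, h⟩, fun h => h.2⟩

/-- Every node of the tree of a class without computable members lies below a leaf. -/
theorem exists_isLeaf {c : Code} {z : List ℕ × List ℕ} (hc : ∀ f ∈ effClass c z, ¬ Computable f)
    {τ : List ℕ} (hτ : Alive c z τ) : ∃ ρ, τ <+: ρ ∧ IsLeaf c z ρ := by
  classical
  -- The extension of `τ` by zeros is computable, hence not in the class; its shortest rejected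
  -- initial segment is the leaf.
  have hcomp : Computable (prepend τ fun _ => 0) :=
    ((Primrec.list_getD 0).comp (Primrec.const τ) Primrec.id).to_comp.of_eq fun n => rfl
  have hbin : ∀ k, ∀ x ∈ initSeg (prepend τ fun _ => 0) (τ.length + k), x < 2 := by
    intro k x hx
    rw [initSeg_prepend] at hx
    rcases List.mem_append.1 hx with h | h
    · exact hτ.1 x h
    · obtain ⟨m, -, rfl⟩ := mem_initSeg.1 h
      omega
  have hex : ∃ k, ¬ Alive c z (initSeg (prepend τ fun _ => 0) (τ.length + k)) := by
    by_contra! H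
    exact hc _ (fun n => (H n).of_prefix (initSeg_prefix _ (by omega))) hcomp
  have hspec := Nat.find_spec hex
  have hmin := fun m => Nat.find_min hex (m := m)
  set k := Nat.find hex
  have hk : k ≠ 0 := by
    intro h0
    rw [h0, initSeg_prepend] at hspec
    exact hspec (by simpa [initSeg] using hτ)
  refine ⟨_, ?_, hbin k, hspec, ?_⟩
  · rw [initSeg_prepend]; exact List.prefix_append _ _
  · rw [initSeg_length, initSeg_take _ (by omega)]
    have := hmin (k - 1) (by omega)
    rw [not_not] at this
    rwa [show τ.length + k - 1 = τ.length + (k - 1) by omega]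

theorem IsLeaf.ne_nil {c : Code} {z : List ℕ × List ℕ} {ρ : List ℕ} (h : IsLeaf c z ρ) :
    ρ ≠ [] := by
  rintro rfl
  exact h.2.1 (Alive.nil c z)

/-! ### Learners -/

theorem foldl_getD_eq {f : ℕ → Option ℕ} {i N : ℕ} (hN : ∀ m ≥ N, f m = none ∨ f m = some i)
    (hf : f N = some i) {k : ℕ} (hk : N < k) (r : ℕ) :
    (List.range k).foldl (fun r m => (f m).getD r) r = i := by
  induction k with
  | zero => omega
  | succ k ih =>
    rw [List.range_succ, List.foldl_append]
    rcases eq_or_lt_of_le (Nat.lt_succ_iff.1 hk) with rfl | h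
    · simp [hf]
    · rw [ih h]
      rcases hN k h.le with h' | h' <;> simp [h']

/-- Once the computation at position `N` has been seen to halt, the most recent value found comes
from a position at or beyond `N`, so the delay and the default 0 no longer matter. -/
theorem LearnerTendsTo.totalLearner {e i : ℕ} {g : ℕ → ℕ} (h : LearnerTendsTo e g i) :
    ∃ N, ∀ n ≥ N, totalLearner e (initSeg g n) = i := by
  obtain ⟨N, hN⟩ := h
  obtain ⟨k, hk⟩ := Code.evaln_complete.1 (hN N le_rfl)
  refine ⟨max N k, fun n hn => ?_⟩
  have hNn : N ≤ n := le_of_max_le_left hn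
  refine (List.foldl_ext _ (fun r m => ((if m ≤ n then Code.evaln n (Denumerable.ofNat Code e)
    (encode (initSeg g m)) else none)).getD r) _ fun r m hm => ?_).trans
    (foldl_getD_eq (N := N) ?_ ?_ ?_ 0)
  · rw [initSeg_length] at hm ⊢
    have hm' : m ≤ n := by simpa [Nat.lt_succ_iff] using hm
    rw [initSeg_take _ hm', if_pos hm']
  · intro m hm
    split_ifs
    · cases hv : Code.evaln n (Denumerable.ofNat Code e) (encode (initSeg g m)) with
      | none => exact Or.inl rfl
      | some v =>
        exact Or.inr (congrArg some (Part.mem_unique (Code.evaln_sound hv) (hN m hm)))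
    · exact Or.inl rfl
  · rw [if_pos hNn]
    exact Code.evaln_mono (le_of_max_le_right hn) hk
  · rw [initSeg_length]; omega

theorem MindChange.mono {e : ℕ} {p s s' : List ℕ} (h : MindChange e p s) (hs : s <+: s') :
    MindChange e p s' := by
  obtain ⟨n, hn, hp, hne⟩ := h
  obtain ⟨t, rfl⟩ := hs
  refine ⟨n, by simp; omega, hp, ?_⟩
  rwa [List.take_append_of_le_length (by omega)]

/-! ### Approximations to functionals -/

theorem foldl_orElse_eq_none {f : ℕ → Option ℕ} {K : ℕ} :
    (List.range K).foldl (fun r k => r <|> f k) none = none ↔ ∀ j < K, f j = none := by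
  induction K with
  | zero => simp
  | succ K ih =>
    rw [List.range_succ, List.foldl_append]
    simp only [List.foldl_cons, List.foldl_nil, Option.orElse_eq_orElse, Option.orElse_eq_or,
      Option.or_eq_none_iff, Nat.lt_succ_iff_lt_or_eq] at ih ⊢
    rw [ih]
    exact ⟨fun h j hj => hj.elim (h.1 j) fun e => e ▸ h.2,
      fun h => ⟨fun j hj => h j (Or.inl hj), h K (Or.inr rfl)⟩⟩

theorem foldl_orElse_eq_some {f : ℕ → Option ℕ} {K v : ℕ} :
    (List.range K).foldl (fun r k => r <|> f k) none = some v ↔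
      ∃ k < K, f k = some v ∧ ∀ j < k, f j = none := by
  induction K with
  | zero => simp
  | succ K ih =>
    have hn := foldl_orElse_eq_none (f := f) (K := K)
    rw [List.range_succ, List.foldl_append]
    simp only [List.foldl_cons, List.foldl_nil, Option.orElse_eq_orElse, Option.orElse_eq_or,
      Option.or_eq_some_iff, Nat.lt_succ_iff_lt_or_eq] at ih hn ⊢
    rw [ih, hn]
    constructor
    · rintro (⟨k, hk, h⟩ | ⟨h1, h2⟩)
      · exact ⟨k, Or.inl hk, h⟩
      · exact ⟨K, Or.inr rfl, h2, h1⟩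
    · rintro ⟨k, hk | rfl, h⟩
      · exact Or.inl ⟨k, hk, h⟩
      · exact Or.inr ⟨h.2, h.1⟩

theorem functionalStage_of_prefix {i n k : ℕ} {σ σ' : List ℕ} (h : σ <+: σ') (hk : k ≤ σ.length) :
    functionalStage i σ' n k = functionalStage i σ n k := by
  obtain ⟨t, rfl⟩ := h
  unfold functionalStage
  rw [List.take_append_of_le_length ((Nat.unpair_left_le k).trans hk)]

/-- Stage `k` consults at most the first `k` entries of the oracle, so the stages searched from `σ`
have the same outcome from `σ'`, and the first success is unchanged. -/
theorem functionalApprox_mono {i n v : ℕ} {σ σ' : List ℕ} (h : σ <+: σ')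
    (hv : functionalApprox i σ n = some v) : functionalApprox i σ' n = some v := by
  obtain ⟨k, hk, h1, h2⟩ := foldl_orElse_eq_some.1 hv
  have hl := h.length_le
  refine foldl_orElse_eq_some.2 ⟨k, by omega, ?_, fun j hj => ?_⟩
  · rwa [functionalStage_of_prefix h (by omega)]
  · rw [functionalStage_of_prefix h (by omega), h2 j hj]

/-- `functionalApprox` runs through the stages in the same order as `turingFunctional`, so both stop
at the same first success. -/
theorem FunctionalEq.exists_approx {i : ℕ} {g y : ℕ → ℕ} (h : FunctionalEq i g y) (n : ℕ) :
    ∃ N, ∀ m ≥ N, functionalApprox i (initSeg g m) n = some (y n) := by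
  obtain ⟨k, hk, hv⟩ := Part.mem_bind_iff.1 (h n)
  have hstage : ∀ m ≥ k, ∀ j ≤ k, functionalStage i (initSeg g m) n j =
      Code.evaln j.unpair.2 (Denumerable.ofNat Code i)
        (Nat.pair (encode (initSeg g j.unpair.1)) n) := by
    intro m hm j hj
    unfold functionalStage
    rw [initSeg_take _ ((Nat.unpair_left_le j).trans (hj.trans hm))]
  refine ⟨k, fun m hm => foldl_orElse_eq_some.2 ⟨k, ?_, ?_, fun j hj => ?_⟩⟩
  · rw [initSeg_length]; omega
  · rw [hstage m hm k le_rfl]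
    simpa using hv
  · rw [hstage m hm j hj.le]
    simpa using Nat.rfind_min hk hj

theorem Agrees.mono {q : Code} {i l : ℕ} {σ σ' : List ℕ} (h : Agrees q i σ l) (hp : σ <+: σ') :
    Agrees q i σ' l := by
  refine ⟨h.1.trans hp.length_le, fun n hn => ?_, ?_⟩
  · obtain ⟨v, hv⟩ := Option.isSome_iff_exists.1 (h.2.1 n hn)
    rw [functionalApprox_mono hp hv]; rfl
  · convert h.2.2 using 1
    refine List.map_congr_left fun n hn => ?_
    obtain ⟨v, hv⟩ := Option.isSome_iff_exists.1 (h.2.1 n (List.mem_range.1 hn))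
    rw [functionalApprox_mono hp hv, hv]

theorem Agrees.anti {q : Code} {i l l' : ℕ} {σ : List ℕ} (h : Agrees q i σ l) (hl : l' ≤ l) :
    Agrees q i σ l' := by
  refine ⟨hl.trans h.1, fun n hn => h.2.1 n (hn.trans_le hl), h.2.2.of_prefix ?_⟩
  exact initSeg_prefix (fun n => (functionalApprox i σ n).getD 0) hl

theorem FunctionalEq.exists_agrees {q : Code} {i : ℕ} {g y : ℕ → ℕ} (h : FunctionalEq i g y)
    (hy : y ∈ effClass q ([], [])) (l : ℕ) : ∃ N, ∀ m ≥ N, Agrees q i (initSeg g m) l := by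
  choose N hN using h.exists_approx
  refine ⟨max l ((Finset.range l).sup N), fun m hm => ?_⟩
  have hm' : ∀ n < l, functionalApprox i (initSeg g m) n = some (y n) := fun n hn =>
    hN n m ((Finset.le_sup (Finset.mem_range.2 hn)).trans (le_of_max_le_right hm))
  refine ⟨by rw [initSeg_length]; exact le_of_max_le_left hm, fun n hn => by rw [hm' n hn]; rfl, ?_⟩
  convert hy l using 1
  refine List.map_congr_left fun n hn => ?_
  rw [hm' n (List.mem_range.1 hn)]; rfl

/-! ### The parser -/

theorem firstStable_eq_none {A p s : List ℕ} :
    firstStable A p s = none ↔ ∀ e ∈ A, MindChange e p s := by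
  simp [firstStable]

theorem firstStable_eq_some {A p s : List ℕ} {e : ℕ} (h : firstStable A p s = some e) :
    e ∈ A ∧ ¬ MindChange e p s := by
  simpa using List.mem_filter.1 (List.mem_of_mem_head? (Option.mem_def.2 h))

section Parser

variable {p q c : Code}

theorem parseStep_eq_some {A : List ℕ} {S S' : ParseState} {x : ℕ}
    (h : parseStep p q c A S x = some S') :
    (firstStable A S.1 S.2.1 = none ∧ Alive p ([], []) (S.2.2.1 ++ [x]) ∧
      S' = (S.2.1 ++ [x], S.2.1 ++ [x], S.2.2.1 ++ [x], [])) ∨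
    ∃ e, firstStable A S.1 S.2.1 = some e ∧
      ((Alive c (A.filter (· ≠ e), S.2.1) (S.2.2.2 ++ [x]) ∧
        S' = (S.1, S.2.1, S.2.2.1, S.2.2.2 ++ [x])) ∨
      (IsFirstHit q c (A.filter (· ≠ e)) e S.1 S.2.1 (S.2.2.2 ++ [x]) ∧
        S' = (S.1, S.2.1 ++ (S.2.2.2 ++ [x]), S.2.2.1, []))) := by
  unfold parseStep at h
  cases hF : firstStable A S.1 S.2.1 with
  | none =>
    simp only [hF, Option.ite_none_right_eq_some, Option.some.injEq] at h
    exact Or.inl ⟨rfl, h.1, h.2.symm⟩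
  | some e =>
    refine Or.inr ⟨e, rfl, ?_⟩
    simp only [hF] at h
    split_ifs at h with h1 h2
    · exact Or.inl ⟨h1, (Option.some.inj h).symm⟩
    · exact Or.inr ⟨h2, (Option.some.inj h).symm⟩

theorem parseStep_code {A : List ℕ} {S : ParseState} {x : ℕ}
    (h : firstStable A S.1 S.2.1 = none) (hx : Alive p ([], []) (S.2.2.1 ++ [x])) :
    parseStep p q c A S x = some (S.2.1 ++ [x], S.2.1 ++ [x], S.2.2.1 ++ [x], []) := by
  simp [parseStep, h, hx]

theorem parseStep_wait {A : List ℕ} {S : ParseState} {x e : ℕ}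
    (h : firstStable A S.1 S.2.1 = some e)
    (hx : Alive c (A.filter (· ≠ e), S.2.1) (S.2.2.2 ++ [x])) :
    parseStep p q c A S x = some (S.1, S.2.1, S.2.2.1, S.2.2.2 ++ [x]) := by
  unfold parseStep
  simp only [h]
  rw [if_pos hx]

theorem parseStep_hit {A : List ℕ} {S : ParseState} {x e : ℕ}
    (h : firstStable A S.1 S.2.1 = some e)
    (hx : IsFirstHit q c (A.filter (· ≠ e)) e S.1 S.2.1 (S.2.2.2 ++ [x])) :
    parseStep p q c A S x = some (S.1, S.2.1 ++ (S.2.2.2 ++ [x]), S.2.2.1, []) := by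
  unfold parseStep
  simp only [h]
  rw [if_neg hx.1.1.2.1, if_pos hx]

theorem parse_nil (z : List ℕ × List ℕ) : parse p q c z [] = some (z.2, z.2, [], []) := rfl

theorem parse_concat (z : List ℕ × List ℕ) (τ : List ℕ) (x : ℕ) :
    parse p q c z (τ ++ [x]) = (parse p q c z τ).bind fun S => parseStep p q c z.1 S x := by
  simp [parse]

theorem parse_ne_none_of_prefix {z : List ℕ × List ℕ} {σ τ : List ℕ} (h : σ <+: τ)
    (hτ : parse p q c z τ ≠ none) : parse p q c z σ ≠ none := by
  obtain ⟨t, rfl⟩ := h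
  induction t using List.reverseRecOn with
  | nil => simpa using hτ
  | append_singleton t x ih =>
    refine ih fun h => hτ ?_
    rw [← List.append_assoc, parse_concat, h]; rfl

/-- The invariants of the parser. -/
structure ParseInv (p c : Code) (z : List ℕ × List ℕ) (τ : List ℕ) (S : ParseState) : Prop where
  append_eq : S.2.1 ++ S.2.2.2 = z.2 ++ τ
  isPrefix : S.1 <+: S.2.1
  length_le : z.2.length ≤ S.1.length
  code_le : S.2.2.1.length ≤ S.1.length
  alive : Alive p ([], []) S.2.2.1
  eq_nil : firstStable z.1 S.1 S.2.1 = none → S.2.2.2 = []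
  block : ∀ e, firstStable z.1 S.1 S.2.1 = some e →
    Alive c (z.1.filter (· ≠ e), S.2.1) S.2.2.2

theorem parseInv {z : List ℕ × List ℕ} {τ : List ℕ} {S : ParseState}
    (h : parse p q c z τ = some S) : ParseInv p c z τ S := by
  induction τ using List.reverseRecOn generalizing S with
  | nil =>
    rw [parse_nil] at h
    obtain rfl := Option.some.inj h
    exact ⟨by simp, List.prefix_rfl, le_rfl, by simp, Alive.nil _ _, fun _ => rfl,
      fun _ _ => Alive.nil _ _⟩
  | append_singleton τ x ih =>
    rw [parse_concat] at h
    obtain ⟨S₀, h0, h1⟩ := Option.bind_eq_some_iff.1 h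
    obtain ⟨i1, i2, i3, i4, i5, i6, i7⟩ := ih h0
    have hpl := i2.length_le
    rcases parseStep_eq_some h1 with ⟨hF, ha, rfl⟩ | ⟨e, hF, ⟨ha, rfl⟩ | ⟨ha, rfl⟩⟩
    · have := i6 hF
      rw [this, List.append_nil] at i1
      exact ⟨by simp [i1], List.prefix_rfl, by simp; omega, by simp; omega, ha, fun _ => rfl,
        fun _ _ => Alive.nil _ _⟩
    · refine ⟨by rw [← List.append_assoc, i1, List.append_assoc], i2, i3, i4, i5, fun h => ?_, fun e' he' => ?_⟩
      · simp [hF] at h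
      · obtain rfl : e = e' := Option.some.inj (hF.symm.trans he')
        exact ha
    · exact ⟨by rw [List.append_nil, ← List.append_assoc, i1, List.append_assoc],
        i2.trans (List.prefix_append _ _), i3, i4, i5, fun _ => rfl,
        fun _ _ => Alive.nil _ _⟩

/-- From a node, the parser stays in the current block while the block is alive. -/
theorem parse_append_of_alive {z : List ℕ × List ℕ} {τ : List ℕ} {S : ParseState} {e : ℕ}
    (h : parse p q c z τ = some S) (hS : S.2.2.2 = [])
    (hF : firstStable z.1 S.1 S.2.1 = some e) {ρ : List ℕ}
    (hρ : Alive c (z.1.filter (· ≠ e), S.2.1) ρ) :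
    parse p q c z (τ ++ ρ) = some (S.1, S.2.1, S.2.2.1, ρ) := by
  induction ρ using List.reverseRecOn with
  | nil => rw [List.append_nil, h, ← hS]
  | append_singleton ρ x ih =>
    rw [← List.append_assoc, parse_concat, ih (hρ.of_prefix (List.prefix_append _ _))]
    exact parseStep_wait (S := (S.1, S.2.1, S.2.2.1, ρ)) hF hρ

/-- A leaf without its last entry is alive, so the parser waits inside the block until that entry
closes it. -/
theorem parse_append_of_isFirstHit {z : List ℕ × List ℕ} {τ : List ℕ} {S : ParseState} {e : ℕ}
    (h : parse p q c z τ = some S) (hS : S.2.2.2 = [])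
    (hF : firstStable z.1 S.1 S.2.1 = some e) {ρ : List ℕ}
    (hρ : IsFirstHit q c (z.1.filter (· ≠ e)) e S.1 S.2.1 ρ) :
    parse p q c z (τ ++ ρ) = some (S.1, S.2.1 ++ ρ, S.2.2.1, []) := by
  have hl := hρ.1.1
  rcases List.eq_nil_or_concat ρ with rfl | ⟨ρ, x, rfl⟩
  · exact absurd rfl hl.ne_nil
  · rw [List.concat_eq_append] at hl hρ ⊢
    have ha := hl.2.2
    simp only [List.length_append, List.length_singleton, Nat.add_sub_cancel,
      List.take_left'] at ha
    rw [← List.append_assoc, parse_concat, parse_append_of_alive h hS hF ha]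
    exact parseStep_hit (S := (S.1, S.2.1, S.2.2.1, ρ)) hF hρ

/-- `st n` is the state of the parser after it has read `h ↾ n`. -/
def IsParse (p q c : Code) (z : List ℕ × List ℕ) (h : ℕ → ℕ) (st : ℕ → ParseState) : Prop :=
  ∀ n, parse p q c z (initSeg h n) = some (st n)

variable {z : List ℕ × List ℕ} {h : ℕ → ℕ} {st : ℕ → ParseState}

theorem IsParse.step (hst : IsParse p q c z h st) (n : ℕ) :
    parseStep p q c z.1 (st n) (h n) = some (st (n + 1)) := by
  have := hst (n + 1)
  rw [initSeg_succ, parse_concat, hst n] at this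
  simpa using this

theorem IsParse.code_prefix_succ (hst : IsParse p q c z h st) (n : ℕ) :
    (st n).2.2.1 <+: (st (n + 1)).2.2.1 := by
  rcases parseStep_eq_some (hst.step n) with ⟨-, -, h'⟩ | ⟨e, -, ⟨-, h'⟩ | ⟨-, h'⟩⟩ <;> rw [h']
  exact List.prefix_append _ _

theorem IsParse.code_prefix (hst : IsParse p q c z h st) {m n : ℕ} (hmn : m ≤ n) :
    (st m).2.2.1 <+: (st n).2.2.1 := by
  induction hmn with
  | refl => exact List.prefix_rfl
  | step _ ih => exact ih.trans (hst.code_prefix_succ _)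

theorem IsParse.node_prefix (hst : IsParse p q c z h st) {m n : ℕ} (hmn : m ≤ n) :
    (st m).2.1 <+: (st n).2.1 := by
  induction hmn with
  | refl => exact List.prefix_rfl
  | @step n _ ih =>
    refine ih.trans ?_
    rcases parseStep_eq_some (hst.step n) with ⟨-, -, h'⟩ | ⟨e, -, ⟨-, h'⟩ | ⟨-, h'⟩⟩ <;> rw [h']
    · exact List.prefix_append _ _
    · exact List.prefix_append _ _

/-- A parse that stays in one block. -/
theorem IsParse.exists_tail_mem (hst : IsParse p q c z h st) {N : ℕ}
    (hN : ∀ n ≥ N, (st n).2.2.2 ≠ []) :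
    ∃ e s m, e ∈ z.1 ∧ (fun k => h (k + m)) ∈ effClass c (z.1.filter (· ≠ e), s) := by
  have hw : ∀ n ≥ N, ∃ e, firstStable z.1 (st n).1 (st n).2.1 = some e ∧
      st (n + 1) = ((st n).1, (st n).2.1, (st n).2.2.1, (st n).2.2.2 ++ [h n]) := by
    intro n hn
    have h2 := hN (n + 1) (by omega)
    rcases parseStep_eq_some (hst.step n) with ⟨-, -, h'⟩ | ⟨e, he, ⟨-, h'⟩ | ⟨-, h'⟩⟩
    · rw [h'] at h2; exact absurd rfl h2
    · exact ⟨e, he, h'⟩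
    · rw [h'] at h2; exact absurd rfl h2
  have hconst : ∀ n ≥ N, (st n).1 = (st N).1 ∧ (st n).2.1 = (st N).2.1 := by
    intro n hn
    induction hn with
    | refl => exact ⟨rfl, rfl⟩
    | @step n hn ih =>
      obtain ⟨e, -, h'⟩ := hw n hn
      rw [h']; exact ih
  obtain ⟨e, he, -⟩ := hw N le_rfl
  -- Nodes are positions in `z.2` followed by `h`; subtracting the length of `z.2` gives the
  -- position in `h` at which the block begins.
  refine ⟨e, (st N).2.1, (st N).2.1.length - z.2.length, (firstStable_eq_some he).1, fun n => ?_⟩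
  set m := (st N).2.1.length - z.2.length
  have hinv := parseInv (hst (m + (n + N)))
  obtain ⟨h1, h2⟩ := hconst (m + (n + N)) (by omega)
  have hb := hinv.block e (by rw [h1, h2]; exact he)
  have hlen := hinv.length_le.trans hinv.isPrefix.length_le
  rw [h2] at hb hlen
  refine hb.of_prefix ?_
  have hap := hinv.append_eq
  rw [h2] at hap
  have hd : (st (m + (n + N))).2.2.2 = (z.2 ++ initSeg h (m + (n + N))).drop (st N).2.1.length := by
    rw [← hap]; simp
  rw [hd, List.drop_append, List.drop_eq_nil_of_le hlen, List.nil_append, initSeg_drop]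
  exact initSeg_prefix _ (by omega)

/-- A parse with infinitely many blocks codes an infinite sequence: otherwise it is eventually
deterministic, and the hypothesis of a stable learner is confirmed infinitely often. -/
theorem IsParse.code_unbounded (hst : IsParse p q c z h st)
    (hq : ∀ f ∈ effClass q ([], []), ¬ Computable f)
    (hnode : ∀ N, ∃ n ≥ N, (st n).2.2.2 = []) (k : ℕ) : ∃ n, k ≤ (st n).2.2.1.length := by
  classical
  by_contra! hk
  -- no bit is coded after `n₀`
  obtain ⟨n₀, hn₀⟩ : ∃ n₀, ∀ n, (st n).2.2.1.length ≤ (st n₀).2.2.1.length := by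
    have hex : ∃ k, ∀ n, (st n).2.2.1.length < k := ⟨k, hk⟩
    have h1 := Nat.find_spec hex
    have h2 := fun m => Nat.find_min hex (m := m)
    set k := Nat.find hex
    have hk0 : k ≠ 0 := fun h => by have := h1 0; omega
    have := h2 (k - 1) (by omega)
    push Not at this
    obtain ⟨n₀, hn₀⟩ := this
    exact ⟨n₀, fun n => by have := h1 n; omega⟩
  have hstep : ∀ n ≥ n₀, ∃ e, firstStable z.1 (st n).1 (st n).2.1 = some e ∧
      (st (n + 1) = ((st n).1, (st n).2.1, (st n).2.2.1, (st n).2.2.2 ++ [h n]) ∨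
      (IsFirstHit q c (z.1.filter (· ≠ e)) e (st n).1 (st n).2.1 ((st n).2.2.2 ++ [h n]) ∧
        st (n + 1) = ((st n).1, (st n).2.1 ++ ((st n).2.2.2 ++ [h n]), (st n).2.2.1, []))) := by
    intro n hn
    rcases parseStep_eq_some (hst.step n) with ⟨-, -, h'⟩ | ⟨e, he, ⟨-, h'⟩ | h'⟩
    · have h1 := hn₀ (n + 1)
      have h2 := (hst.code_prefix hn).length_le
      rw [h'] at h1
      simp at h1
      omega
    · exact ⟨e, he, Or.inl h'⟩
    · exact ⟨e, he, Or.inr h'⟩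
  have hP : ∀ n ≥ n₀, (st n).1 = (st n₀).1 := by
    intro n hn
    induction hn with
    | refl => rfl
    | @step n hn ih =>
      obtain ⟨e, -, h' | ⟨-, h'⟩⟩ := hstep n hn <;> rw [h'] <;> exact ih
  set P := (st n₀).1
  -- the first stable learner is constant after `n₁`
  let F : ℕ → List ℕ := fun n => z.1.filter fun e => ¬ MindChange e P (st n).2.1
  obtain ⟨n₁, hn₁, hmin⟩ : ∃ n₁ ≥ n₀, ∀ n ≥ n₀, (F n₁).length ≤ (F n).length := by
    have hex : ∃ l, ∃ n ≥ n₀, (F n).length = l := ⟨_, n₀, le_rfl, rfl⟩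
    obtain ⟨n₁, h1, h2⟩ := Nat.find_spec hex
    exact ⟨n₁, h1, fun n hn => h2 ▸ Nat.find_min' hex ⟨n, hn, rfl⟩⟩
  -- Mind changes persist, so `F n` is a sublist of `F n₁`, whose length is already minimal.
  have hF : ∀ n ≥ n₁, F n = F n₁ := by
    intro n hn
    refine List.Sublist.eq_of_length_le (List.monotone_filter_right _ fun e he => ?_)
      (hmin n (hn₁.trans hn))
    simp only [decide_eq_true_eq] at he ⊢
    exact fun hm => he (hm.mono (hst.node_prefix hn))
  obtain ⟨e, he, -⟩ := hstep n₁ hn₁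
  have hfs : ∀ n ≥ n₁, firstStable z.1 P (st n).2.1 = some e := by
    intro n hn
    rw [hP n₁ hn₁] at he
    rw [← he]
    exact congrArg List.head? (hF n hn)
  set B := z.1.filter (· ≠ e) with hB
  set i := totalLearner e P
  -- The next node is found by searching for the first hit, without consulting `h`. The search is
  -- only partial, but it succeeds at the nodes of the parse.
  let next : List ℕ → Part (List ℕ) := fun s =>
    (Nat.rfind fun n => (Part.some (decide (IsHit q c B e P s (Denumerable.ofNat (List ℕ) n))))).map
      fun n => s ++ Denumerable.ofNat (List ℕ) n
  have hnext : Partrec next := by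
    refine Partrec.map (g := fun s n => s ++ Denumerable.ofNat (List ℕ) n) (Partrec.rfind ?_) ?_
    · refine Computable.partrec (Primrec.to_comp ?_)
      exact (primrecPred_isHit (Primrec.const c) (Primrec.const B) (Primrec.const e)
        (Primrec.const P) Primrec.fst ((Primrec.ofNat (List ℕ)).comp Primrec.snd)).decide
    · exact (Primrec.list_append.comp Primrec.fst
        ((Primrec.ofNat (List ℕ)).comp Primrec.snd)).to_comp
  have hadv : ∀ n ≥ n₁, (st n).2.2.2 = [] → ∃ n' ≥ n₁, (st n').2.2.2 = [] ∧
      (st n').2.1 ∈ next (st n).2.1 ∧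
      ∃ l, Agrees q i (st n').2.1 l ∧ ¬ Agrees q i (st n).2.1 l := by
    intro n hn hρ
    have hex : ∃ m, n < m ∧ (st m).2.2.2 = [] := by
      obtain ⟨m, hm, h'⟩ := hnode (n + 1)
      exact ⟨m, hm, h'⟩
    obtain ⟨hm1, hm2⟩ := Nat.find_spec hex
    have hm3 := fun m => Nat.find_min hex (m := m)
    set m := Nat.find hex
    have hsame : ∀ j ≥ n, j < m → (st j).2.1 = (st n).2.1 := by
      intro j hj
      induction hj with
      | refl => intro _; rfl
      | @step j hj ih =>
        intro hjm
        have hj' : n ≤ j := hj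
        rw [← ih (by omega)]
        obtain ⟨e', -, h' | ⟨-, h'⟩⟩ := hstep j (by omega)
        · rw [h']
        · exact absurd ⟨by omega, by rw [h']⟩ (hm3 (j + 1) hjm)
    clear_value m
    obtain ⟨j, rfl⟩ : ∃ j, m = j + 1 := ⟨m - 1, by omega⟩
    have hsj := hsame j (by omega) (by omega)
    obtain ⟨e', he', h' | ⟨hh, h'⟩⟩ := hstep j (by omega)
    · rw [h'] at hm2; simp at hm2
    · rw [hP j (by omega)] at he' hh
      rw [hfs j (by omega)] at he'
      obtain rfl := Option.some.inj he'
      rw [hsj, ← hB] at hh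
      refine ⟨j + 1, by omega, hm2, ?_, ?_⟩
      · rw [h', hsj]
        refine (Part.mem_map_iff _).2 ⟨encode ((st j).2.2.2 ++ [h j]), ?_, by simp⟩
        refine Nat.mem_rfind.2 ⟨?_, fun {k} hk => ?_⟩
        · simpa using hh.1
        · simpa using hh.2 k hk
      · have hs' : (st (j + 1)).2.1 = (st n).2.1 ++ ((st j).2.2.2 ++ [h j]) := by rw [h', hsj]
        -- Progress cannot be a mind change, since `e` is still stable at the later node; so it is a
        -- new length of agreement.
        rcases hh.1.2 with hmc | ⟨l, -, hl⟩
        · rw [← hs'] at hmc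
          exact absurd hmc (firstStable_eq_some (hfs (j + 1) (by omega))).2
        · exact ⟨l, by rw [hs']; exact hl⟩
  obtain ⟨n₂, hn₂, hρ₂⟩ := hnode n₁
  let orbit : ℕ → Part (List ℕ) := fun k =>
    Nat.rec (Part.some (st n₂).2.1) (fun _ IH => IH.bind next) k
  have horb : ∀ k, ∃ s, s ∈ orbit k ∧ Agrees q i s k := by
    have : ∀ k, ∃ n ≥ n₁, (st n).2.2.2 = [] ∧ (st n).2.1 ∈ orbit k ∧ Agrees q i (st n).2.1 k := by
      intro k
      induction k with
      | zero =>
        exact ⟨n₂, hn₂, hρ₂, Part.mem_some _, Nat.zero_le _, fun n hn => absurd hn (by omega),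
          Alive.nil _ _⟩
      | succ k ih =>
        obtain ⟨n, hn, hρ, ho, ha⟩ := ih
        obtain ⟨n', hn', hρ', ho', l, hl, hl'⟩ := hadv n hn hρ
        -- Agreement is downward closed in the length, so a newly attained length exceeds `k`.
        refine ⟨n', hn', hρ', Part.mem_bind_iff.2 ⟨_, ho, ho'⟩, hl.anti ?_⟩
        by_contra hlt
        exact hl' (ha.anti (by omega))
    intro k
    obtain ⟨n, -, -, h1, h2⟩ := this k
    exact ⟨_, h1, h2⟩
  choose v hv hvA using horb
  have hvc : Computable v := by
    refine Partrec.of_eq_tot (f := orbit) ?_ hv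
    exact Partrec.nat_rec (f := fun k : ℕ => k) (g := fun _ => Part.some (st n₂).2.1)
      (h := fun _ y => next y.2) Computable.id (Computable.const _).partrec
      (hnext.comp (Computable.snd.comp Computable.snd)).to₂
  have hvp : ∀ k, v k <+: v (k + 1) := by
    intro k
    obtain ⟨s, hs, hs'⟩ := Part.mem_bind_iff.1 (hv (k + 1))
    rw [Part.mem_unique hs (hv k)] at hs'
    obtain ⟨n, -, hn⟩ := (Part.mem_map_iff _).1 hs'
    rw [← hn]
    exact List.prefix_append _ _
  have hvp' : ∀ j k, j ≤ k → v j <+: v k := by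
    intro j k hjk
    induction hjk with
    | refl => exact List.prefix_rfl
    | step _ ih => exact ih.trans (hvp _)
  -- The node `v (l + 1)` already determines the values at arguments up to `l`, so the default 0 is
  -- never used. The resulting computable sequence lies in the class of `q`.
  refine hq (fun l => (functionalApprox i (v (l + 1)) l).getD 0) (fun n => ?_) ?_
  · convert (hvA n).2.2 using 1
    refine List.map_congr_left fun j hj => ?_
    obtain ⟨w, hw⟩ := Option.isSome_iff_exists.1 ((hvA (j + 1)).2.1 j (by omega))
    rw [hw, functionalApprox_mono (hvp' (j + 1) n (List.mem_range.1 hj)) hw]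
  · have : Computable fun x : List ℕ × ℕ => (functionalApprox i x.1 x.2).getD 0 :=
      (Primrec.option_getD.comp (primrec_functionalApprox (Primrec.const i) Primrec.fst
        Primrec.snd) (Primrec.const 0)).to_comp
    have h2 : Computable fun l => (v (l + 1), l) := (hvc.comp Computable.succ).pair Computable.id
    exact (this.comp h2).of_eq fun l => rfl

end Parser

/-! ### Limits of strings -/

theorem eq_initSeg_of_prefix {g : ℕ → ℕ} {s : List ℕ} {n : ℕ} (h : s <+: initSeg g n) :
    s = initSeg g s.length := by
  have hl := h.length_le
  rw [initSeg_length] at hl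
  rw [List.prefix_iff_eq_take.1 h]
  rw [initSeg_take g hl, initSeg_length]

theorem exists_limit {t : ℕ → List ℕ} (ht : ∀ m n, m ≤ n → t m <+: t n)
    (hl : ∀ k, ∃ n, k ≤ (t n).length) : ∃ f : ℕ → ℕ, ∀ n, t n = initSeg f (t n).length := by
  choose N hN using hl
  refine ⟨fun k => (t (N (k + 1))).getD k 0, fun n => ?_⟩
  refine List.ext_getElem (by rw [initSeg_length]) fun k h1 h2 => ?_
  have hk := hN (k + 1)
  have e1 := (ht n _ (le_max_left n (N (k + 1)))).getElem h1
  have e2 := (ht (N (k + 1)) _ (le_max_right n (N (k + 1)))).getElem (i := k) (by omega)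
  simp only [initSeg, List.getElem_map, List.getElem_range]
  rw [List.getD_eq_getElem _ _ (by omega), e1, e2]

/-! ### Failure of learners -/

/-- The learner `e` does not identify a function that maps `g` into `effClass q`. -/
def Fails (q : Code) (e : ℕ) (g : ℕ → ℕ) : Prop :=
  ∀ i y, LearnerTendsTo e g i → FunctionalEq i g y → y ∉ effClass q ([], [])

/-- Mind changes that begin arbitrarily far out exclude convergence, so failure is vacuous. -/
theorem fails_of_mindChange {q : Code} {e : ℕ} {g : ℕ → ℕ}
    (H : ∀ N, ∃ p s n, N ≤ p.length ∧ p <+: s ∧ s <+: initSeg g n ∧ MindChange e p s) :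
    Fails q e g := by
  intro i y hi _ _
  obtain ⟨N, hN⟩ := hi.totalLearner
  obtain ⟨p, s, n, hp, hps, hs, m, hm, hpm, hne⟩ := H N
  refine hne ?_
  have h1 := eq_initSeg_of_prefix ((List.take_prefix m s).trans hs)
  have h2 := eq_initSeg_of_prefix (hps.trans hs)
  have hl : (s.take m).length = m := by simp; omega
  rw [h1, h2, hN _ hp, hN _ (by rw [hl]; omega)]

/-- A mind change after `p`, or a sufficiently long agreement, shows on an initial segment of the
sequence. It persists at any leaf above that segment, and this leaf would be a hit. So `e` keeps the
hypothesis it has at `p`, and that hypothesis is wrong. -/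
theorem fails_of_not_isHit {q c : Code} {A : List ℕ} {e : ℕ} {p s : List ℕ} {h : ℕ → ℕ}
    (hleaf : ∀ τ, Alive c (A, s) τ → ∃ ρ, τ <+: ρ ∧ IsLeaf c (A, s) ρ)
    (hh : h ∈ effClass c (A, s)) (hH : ∀ ρ, ¬ IsHit q c A e p s ρ) :
    Fails q e (prepend s h) := by
  intro i y hi hy hyq
  obtain ⟨N, hN⟩ := hi.totalLearner
  have hstable : ∀ n, p.length ≤ n →
      totalLearner e (initSeg (prepend s h) n) = totalLearner e p := by
    intro n hn
    by_contra hne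
    obtain ⟨ρ, hρ, hl⟩ := hleaf _ (hh n)
    have hpre : initSeg (prepend s h) n <+: s ++ ρ := by
      refine (initSeg_prefix _ (show n ≤ s.length + n by omega)).trans ?_
      rw [initSeg_prepend]
      exact (List.prefix_append_right_inj s).2 hρ
    have hlen := hpre.length_le
    rw [initSeg_length] at hlen
    refine hH ρ ⟨hl, Or.inl ⟨n, by omega, hn, ?_⟩⟩
    have := List.prefix_iff_eq_take.1 hpre
    rw [initSeg_length] at this
    rwa [← this]
  have hip : i = totalLearner e p := by
    rw [← hN (max N p.length) (le_max_left _ _), hstable _ (le_max_right _ _)]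
  -- `Agrees` bounds the length of agreement by that of the string, so length `s.length + 1` is
  -- certainly new relative to `s`.
  obtain ⟨M, hM⟩ := hy.exists_agrees hyq (s.length + 1)
  obtain ⟨ρ, hρ, hl⟩ := hleaf _ (hh M)
  have hA := hM (s.length + M) (by omega)
  rw [initSeg_prepend, hip] at hA
  have hA' := hA.mono ((List.prefix_append_right_inj s).2 hρ)
  refine hH ρ ⟨hl, Or.inr ⟨s.length + 1, Nat.lt_succ_of_le hA'.1, hA', fun h' => ?_⟩⟩
  have := h'.1
  omega

/-! ### The classes defined by the parser -/

theorem length_filter_ne_lt {A : List ℕ} {e : ℕ} (h : e ∈ A) :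
    (A.filter (· ≠ e)).length < A.length :=
  List.length_filter_lt_length_iff_exists.2 ⟨e, h, by simp⟩

section ParserClass

variable {p q c : Code}

theorem mem_effClass_iff_parse
    (hc : ∀ z τ, (Code.eval c (encode (z, τ))).Dom ↔ parse p q c z τ = none)
    {z : List ℕ × List ℕ} {h : ℕ → ℕ} :
    h ∈ effClass c z ↔ h ∈ cantorSpace ∧ ∀ n, parse p q c z (initSeg h n) ≠ none := by
  rw [mem_effClass_iff]
  simp only [hc]

theorem exists_isParse
    (hc : ∀ z τ, (Code.eval c (encode (z, τ))).Dom ↔ parse p q c z τ = none)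
    {z : List ℕ × List ℕ} {h : ℕ → ℕ} (hh : h ∈ effClass c z) : ∃ st, IsParse p q c z h st := by
  have := fun n => Option.ne_none_iff_exists'.1 (((mem_effClass_iff_parse hc).1 hh).2 n)
  choose st hst using this
  exact ⟨st, hst⟩

/-- The sequence coded in an infinite parse. -/
theorem IsParse.exists_turingLE {z : List ℕ × List ℕ} {h : ℕ → ℕ} {st : ℕ → ParseState}
    (hst : IsParse p q c z h st) (hu : ∀ k, ∃ n, k ≤ (st n).2.2.1.length) :
    ∃ f ∈ effClass p ([], []), TuringLE f h := by
  obtain ⟨f, hf⟩ := exists_limit (t := fun n => (st n).2.2.1) (fun m n => hst.code_prefix) hu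
  refine ⟨f, fun k => ?_, ?_⟩
  · obtain ⟨n, hn⟩ := hu k
    refine (parseInv (hst n)).alive.of_prefix ?_
    rw [hf n]
    exact initSeg_prefix f hn
  · refine TuringLE.of_approx
      (F := fun τ k => (parse p q c z τ).bind fun S => S.2.2.1[k]?) ?_ ?_ ?_
    · refine (Primrec.option_bind (primrec_parse (Primrec.const c) (Primrec.const z) Primrec.fst)
        ?_).to_comp
      exact Primrec.list_getElem?.comp (Primrec.fst.comp (Primrec.snd.comp
        (Primrec.snd.comp Primrec.snd))) (Primrec.snd.comp Primrec.fst)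
    · intro l k v hv
      rw [hst l] at hv
      have hv' : (st l).2.2.1[k]? = some v := hv
      rw [hf l] at hv'
      exact ((initSeg_getElem? f _ k v).1 hv').2
    · intro k
      obtain ⟨n, hn⟩ := hu (k + 1)
      refine ⟨n, ?_⟩
      rw [hst n]
      have hk : k < (st n).2.2.1.length := hn
      simp [hk]

/-- Induction on the length of `A`: either the parse has infinitely many nodes and codes a member of
the class of `p`, or a tail of `h` lies in the class for `A` without one learner. -/
theorem exists_turingLE_of_mem_effClass
    (hc : ∀ z τ, (Code.eval c (encode (z, τ))).Dom ↔ parse p q c z τ = none)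
    (hq : ∀ f ∈ effClass q ([], []), ¬ Computable f) {A σ : List ℕ} {h : ℕ → ℕ}
    (hh : h ∈ effClass c (A, σ)) : ∃ f ∈ effClass p ([], []), TuringLE f h := by
  induction hA : A.length using Nat.strong_induction_on generalizing A σ h with
  | _ N ih =>
    obtain ⟨st, hst⟩ := exists_isParse hc hh
    by_cases hnode : ∀ N, ∃ n ≥ N, (st n).2.2.2 = []
    · exact hst.exists_turingLE (hst.code_unbounded hq hnode)
    · push Not at hnode
      obtain ⟨M, hM⟩ := hnode
      obtain ⟨e, s, m, he, ht⟩ := hst.exists_tail_mem hM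
      obtain ⟨f, hf, hle⟩ := ih _ (hA ▸ length_filter_ne_lt he) ht rfl
      exact ⟨f, hf, hle.trans' (turingLE_shift h m)⟩

theorem prepend_prepend (σ τ : List ℕ) (h : ℕ → ℕ) :
    prepend σ (prepend τ h) = prepend (σ ++ τ) h := by
  funext n
  unfold prepend
  by_cases hn : n < σ.length
  · simp [hn, List.getElem?_append_left hn]
  · rw [List.getD_append_right _ _ _ _ (by omega), List.getD_eq_default _ _ (by omega)]
    congr 1
    simp; congr 1; omega

/-- Induction on the length of `A`, following the parses that code `f`. A learner that blocks the
coding forever fails inside its block; if none does, all learners in `A` diverge. -/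
theorem exists_fails
    (hc : ∀ z τ, (Code.eval c (encode (z, τ))).Dom ↔ parse p q c z τ = none)
    (hq : ∀ f ∈ effClass q ([], []), ¬ Computable f)
    (hp : ∀ f ∈ effClass p ([], []), ¬ Computable f) {f : ℕ → ℕ} (hf : f ∈ effClass p ([], []))
    (A σ : List ℕ) : ∃ h ∈ effClass c (A, σ), ∀ e ∈ A, Fails q e (prepend σ h) := by
  induction hA : A.length using Nat.strong_induction_on generalizing A σ with
  | _ N ih =>
    have hleaf : ∀ z τ, Alive c z τ → ∃ ρ, τ <+: ρ ∧ IsLeaf c z ρ := by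
      rintro ⟨B, s⟩ τ hτ
      refine exists_isLeaf (fun g hg hcomp => ?_) hτ
      obtain ⟨f', hf', hle⟩ := exists_turingLE_of_mem_effClass hc hq hg
      exact hp f' hf' (hle.computable hcomp)
    -- the nodes at which the coded string is an initial segment of `f`
    let Good : List ℕ → ParseState → Prop := fun τ S =>
      parse p q c (A, σ) τ = some S ∧ S.2.2.2 = [] ∧ S.2.2.1 <+: initSeg f S.2.2.1.length ∧
        ∀ x ∈ τ, x < 2
    by_cases hwait : ∃ τ S e, Good τ S ∧ firstStable A S.1 S.2.1 = some e ∧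
      ∀ ρ, ¬ IsHit q c (A.filter (· ≠ e)) e S.1 S.2.1 ρ
    · obtain ⟨τ, S, e, ⟨hS, hρ, -, hbin⟩, hF, hH⟩ := hwait
      obtain ⟨heA, -⟩ := firstStable_eq_some hF
      obtain ⟨h, hh, hfail⟩ := ih _ (hA ▸ length_filter_ne_lt heA) (A.filter (· ≠ e)) S.2.1 rfl
      have hs : S.2.1 = σ ++ τ := by
        have := (parseInv hS).append_eq
        rwa [hρ, List.append_nil] at this
      refine ⟨prepend τ h, (mem_effClass_iff_parse hc).2 ⟨fun n => ?_, fun n => ?_⟩, ?_⟩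
      · unfold prepend
        by_cases hn : n < τ.length
        · rw [List.getD_eq_getElem _ _ hn]
          exact hbin _ (List.getElem_mem hn)
        · rw [List.getD_eq_default _ _ (by omega)]
          exact effClass_subset_cantorSpace _ _ hh _
      · refine parse_ne_none_of_prefix (initSeg_prefix _ (show n ≤ τ.length + n by omega)) ?_
        rw [initSeg_prepend, parse_append_of_alive hS hρ hF (hh n)]
        simp
      · rw [prepend_prepend, ← hs]
        intro e' he'
        by_cases hee : e' = e
        · subst hee
          exact fails_of_not_isHit (hleaf _) hh hH
        · exact hfail e' (List.mem_filter.2 ⟨he', by simpa using hee⟩)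
    · push Not at hwait
      have hnext : ∀ τ S, Good τ S → ∃ τ' S', Good τ' S' ∧ τ <+: τ' ∧ τ.length < τ'.length := by
        rintro τ S ⟨hS, hρ, hφ, hbin⟩
        have hfbin := effClass_subset_cantorSpace _ _ hf
        cases hF : firstStable A S.1 S.2.1 with
        | none =>
          have hcode : S.2.2.1 ++ [f S.2.2.1.length] = initSeg f (S.2.2.1.length + 1) := by
            rw [initSeg_succ, ← eq_initSeg_of_prefix hφ]
          have hstep := parseStep_code (p := p) (q := q) (c := c) (A := A) hF
            (hcode ▸ hf (S.2.2.1.length + 1))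
          refine ⟨τ ++ [f S.2.2.1.length], _, ⟨by rw [parse_concat, hS]; exact hstep, rfl, ?_, ?_⟩,
            List.prefix_append _ _, by simp⟩
          · dsimp only
            rw [hcode, initSeg_length]
          · intro x hx
            rcases List.mem_append.1 hx with h | h
            · exact hbin x h
            · rw [List.mem_singleton.1 h]; exact hfbin _
        | some e =>
          obtain ⟨ρ, hhit⟩ := hwait τ S e ⟨hS, hρ, hφ, hbin⟩ hF
          have hfirst : ∃ ρ, IsFirstHit q c (A.filter (· ≠ e)) e S.1 S.2.1 ρ := by
            classical
            have hex : ∃ n, IsHit q c (A.filter (· ≠ e)) e S.1 S.2.1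
                (Denumerable.ofNat (List ℕ) n) := ⟨encode ρ, by simpa using hhit⟩
            refine ⟨_, Nat.find_spec hex, fun n hn => Nat.find_min hex ?_⟩
            simpa using hn
          obtain ⟨ρ, hρ'⟩ := hfirst
          refine ⟨τ ++ ρ, _, ⟨parse_append_of_isFirstHit hS hρ hF hρ', rfl, hφ, ?_⟩,
            List.prefix_append _ _, ?_⟩
          · intro x hx
            exact (List.mem_append.1 hx).elim (hbin x) (hρ'.1.1.1 x)
          · have := List.length_pos_iff.2 hρ'.1.1.ne_nil
            simp; omega
      choose! nt nS hgood hpre hlt using hnext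
      let sq : ℕ → List ℕ × ParseState := fun k =>
        Nat.rec ([], (σ, σ, [], [])) (fun _ x => (nt x.1 x.2, nS x.1 x.2)) k
      have hsq : ∀ k, Good (sq k).1 (sq k).2 := by
        intro k
        induction k with
        | zero => exact ⟨parse_nil _, rfl, List.nil_prefix, by simp [sq]⟩
        | succ k ih => exact hgood _ _ ih
      have hmono : ∀ m n, m ≤ n → (sq m).1 <+: (sq n).1 := by
        intro m n hmn
        induction hmn with
        | refl => exact List.prefix_rfl
        | step _ ih => exact ih.trans (hpre _ _ (hsq _))
      have hlen : ∀ k, k ≤ (sq k).1.length := by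
        intro k
        induction k with
        | zero => omega
        | succ k ih => exact Nat.succ_le_of_lt (ih.trans_lt (hlt _ _ (hsq k)))
      obtain ⟨h, hh⟩ := exists_limit hmono fun k => ⟨k, hlen k⟩
      have hseg : ∀ n, initSeg h n <+: (sq n).1 := by
        intro n
        rw [hh n]
        exact initSeg_prefix h (hlen n)
      have hmem : h ∈ effClass c (A, σ) := by
        refine (mem_effClass_iff_parse hc).2 ⟨fun n => ?_, fun n => ?_⟩
        · exact (hsq (n + 1)).2.2.2 _ ((hseg (n + 1)).subset (mem_initSeg.2 ⟨n, by omega, rfl⟩))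
        · refine parse_ne_none_of_prefix (hseg n) ?_
          rw [(hsq n).1]; simp
      obtain ⟨st, hst⟩ := exists_isParse hc hmem
      have hu := hst.code_unbounded hq fun N => by
        refine ⟨(sq N).1.length, hlen N, ?_⟩
        have := hst (sq N).1.length
        rw [← hh N, (hsq N).1] at this
        rw [← Option.some.inj this]
        exact (hsq N).2.1
      refine ⟨h, hmem, fun e he => fails_of_mindChange fun N => ?_⟩
      -- The bit that brings the code to length `N + 1` is written only after all of `A` have
      -- changed their minds since the last coded position. That position is at least `N`, since by
      -- `code_le` it is no shorter than the code.
      have hex : ∃ n, N + 1 ≤ (st n).2.2.1.length := hu (N + 1)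
      classical
      have h1 := Nat.find_spec hex
      have h2 := fun m => Nat.find_min hex (m := m)
      set n := Nat.find hex
      clear_value n
      have hn0 : n ≠ 0 := by
        rintro rfl
        have := hst 0
        rw [show initSeg h 0 = [] from rfl, parse_nil] at this
        rw [← Option.some.inj this] at h1
        simp at h1
      obtain ⟨m, rfl⟩ := Nat.exists_eq_succ_of_ne_zero hn0
      have h3 := h2 m (by omega)
      have hinv := parseInv (hst m)
      rcases parseStep_eq_some (hst.step m) with ⟨hF, -, h'⟩ | ⟨e', -, ⟨-, h'⟩ | ⟨-, h'⟩⟩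
      · rw [h'] at h1
        simp only [List.length_append, List.length_singleton] at h1
        refine ⟨(st m).1, (st m).2.1, σ.length + m, ?_, hinv.isPrefix, ?_,
          firstStable_eq_none.1 hF e he⟩
        · have := hinv.code_le
          omega
        · rw [initSeg_prepend]
          have := hinv.append_eq
          dsimp only at this
          rw [← this]
          exact List.prefix_append _ _
      · rw [h'] at h1; exact absurd h1 h3
      · rw [h'] at h1; exact absurd h1 h3

end ParserClass

/-! ### The separation -/

/-- The tree of `P`, with a class that diagonalizes against `n` learners put on top of each leaf of
length `n`. -/
def leafExtension (p c : Code) : Set (List ℕ) := {τ | Alive p ([], []) τ ∨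
  ∃ m < τ.length + 1, IsLeaf p ([], []) (τ.take m) ∧
    Alive c (List.range m, τ.take m) (τ.drop m)}

theorem computablePred_leafExtension (p c : Code) :
    ComputablePred fun τ => τ ∈ leafExtension p c := by
  refine PrimrecPred.computablePred (PrimrecPred.or
    (primrecPred_alive (Primrec.const p) (Primrec.const ([], [])) Primrec.id) ?_)
  refine PrimrecPred.exists_lt_of (R := fun m τ => IsLeaf p ([], []) (τ.take m) ∧
    Alive c (List.range m, τ.take m) (τ.drop m)) ?_ (Primrec.succ.comp Primrec.list_length)
  have ht : Primrec fun x : ℕ × List ℕ => x.2.take x.1 :=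
    Primrec.list_take.comp Primrec.fst Primrec.snd
  exact (primrecPred_isLeaf (Primrec.const p) (Primrec.const ([], [])) ht).and
    (primrecPred_alive (Primrec.const c) ((Primrec.list_range.comp Primrec.fst).pair ht)
      (Primrec.list_drop.comp Primrec.fst Primrec.snd))

/-- An initial segment of a string above a leaf either still contains the leaf or is a proper
initial segment of it, hence alive for `p`. -/
theorem isTree_leafExtension (p c : Code) : IsTree (leafExtension p c) := by
  rintro σ τ hp (h | ⟨m, hm, hl, ha⟩)
  · exact Or.inl (h.of_prefix hp)
  · have hlm : (τ.take m).length = m := by simp; omega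
    have hσl := hp.length_le
    by_cases hσ : m < σ.length + 1
    · have e1 : σ.take m = τ.take m := by
        obtain ⟨t, rfl⟩ := hp
        rw [List.take_append_of_le_length (by omega)]
      refine Or.inr ⟨m, hσ, e1 ▸ hl, ?_⟩
      rw [e1]
      refine ha.of_prefix ?_
      obtain ⟨t, rfl⟩ := hp
      rw [List.drop_append_of_le_length (by omega)]
      exact List.prefix_append _ _
    · refine Or.inl (hl.2.2.of_prefix ?_)
      rw [hlm, List.take_take, min_eq_left (by omega)]
      obtain ⟨t, rfl⟩ := hp
      rw [List.take_append]
      rw [List.take_of_length_le (by omega)]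
      exact List.prefix_append _ _

theorem effClass_subset_paths (p c : Code) : effClass p ([], []) ⊆ paths (leafExtension p c) :=
  fun _ hf n => Or.inl (hf n)

theorem prepend_mem_paths {p c : Code} {ρ : List ℕ} {h : ℕ → ℕ} (hρ : IsLeaf p ([], []) ρ)
    (hh : h ∈ effClass c (List.range ρ.length, ρ)) : prepend ρ h ∈ paths (leafExtension p c) := by
  intro n
  refine isTree_leafExtension p c _ _ (initSeg_prefix _ (show n ≤ ρ.length + n by omega)) ?_
  rw [initSeg_prepend]
  refine Or.inr ⟨ρ.length, by simp, ?_, ?_⟩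
  · simpa using hρ
  · simpa using hh n

/-- A path leaving the tree of `p` passes through only one leaf, so the witnesses `m` found at
different lengths coincide. -/
theorem exists_tail_of_mem_paths {p c : Code} {g : ℕ → ℕ} (hg : g ∈ paths (leafExtension p c)) :
    g ∈ effClass p ([], []) ∨
      ∃ m, (fun k => g (k + m)) ∈ effClass c (List.range m, initSeg g m) := by
  by_cases hp : g ∈ effClass p ([], [])
  · exact Or.inl hp
  · have hp' : ∃ N, ¬ Alive p ([], []) (initSeg g N) := by simpa [effClass] using hp
    obtain ⟨N, hN⟩ := hp'
    have key : ∀ n ≥ N, ∃ m ≤ n, IsLeaf p ([], []) (initSeg g m) ∧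
        Alive c (List.range m, initSeg g m) ((initSeg g n).drop m) := by
      intro n hn
      rcases hg n with h | ⟨m, hm, hl, ha⟩
      · exact absurd (h.of_prefix (initSeg_prefix g hn)) hN
      · rw [initSeg_length] at hm
        rw [initSeg_take g (by omega)] at hl ha
        exact ⟨m, by omega, hl, ha⟩
    have huniq : ∀ m m', IsLeaf p ([], []) (initSeg g m) → IsLeaf p ([], []) (initSeg g m') →
        ¬ m < m' := by
      intro m m' h h' hlt
      have := h'.2.2
      rw [initSeg_length, initSeg_take g (by omega)] at this
      exact h.2.1 (this.of_prefix (initSeg_prefix g (by omega)))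
    obtain ⟨m, -, hl, -⟩ := key N le_rfl
    refine Or.inr ⟨m, fun n => ?_⟩
    obtain ⟨m', -, hl', ha⟩ := key (m + (n + N)) (by omega)
    obtain rfl : m = m' := le_antisymm (not_lt.1 (huniq _ _ hl' hl)) (not_lt.1 (huniq _ _ hl hl'))
    rw [initSeg_drop] at ha
    exact ha.of_prefix (initSeg_prefix _ (by omega))

theorem paths_leafExtension_subset_cantorSpace (p c : Code) :
    paths (leafExtension p c) ⊆ cantorSpace := by
  intro g hg n
  have hmem : g n ∈ initSeg g (n + 1) := mem_initSeg.2 ⟨n, by omega, rfl⟩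
  rcases hg (n + 1) with h | ⟨m, -, hl, ha⟩
  · exact h.1 _ hmem
  · rw [← List.take_append_drop m (initSeg g (n + 1))] at hmem
    exact (List.mem_append.1 hmem).elim (hl.1 _) (ha.1 _)

theorem exists_not_teamReducible {P Q : Set (ℕ → ℕ)} (hP : IsPi01Cantor P) (hPs : IsSpecial P)
    (hQ : IsPi01Cantor Q) (hQs : IsSpecial Q) :
    ∃ P' : Set (ℕ → ℕ), IsPi01Cantor P' ∧ P ⊆ P' ∧ (∀ g ∈ P', ∃ f ∈ P, TuringLE f g) ∧
      ¬ TeamReducible Q P' := by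
  obtain ⟨p, rfl⟩ := hP.exists_code
  obtain ⟨q, rfl⟩ := hQ.exists_code
  obtain ⟨c, hc⟩ := exists_code_parse p q
  obtain ⟨f, hf⟩ := hPs.1
  refine ⟨paths (leafExtension p c), ⟨paths_leafExtension_subset_cantorSpace p c, _,
    isTree_leafExtension p c, computablePred_leafExtension p c, rfl⟩, effClass_subset_paths p c,
    fun g hg => ?_, ?_⟩
  · rcases exists_tail_of_mem_paths hg with h | ⟨m, hm⟩
    · exact ⟨g, h, TuringLE.rfl' g⟩
    · obtain ⟨f', hf', hle⟩ := exists_turingLE_of_mem_effClass hc hQs.2 hm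
      exact ⟨f', hf', hle.trans' (turingLE_shift g m)⟩
  · rintro ⟨Γ, ⟨b, hb⟩, hΓ⟩
    -- A leaf above `initSeg f b` has length at least `b`, so the list `List.range ρ.length`
    -- contains the whole team.
    obtain ⟨ρ, hρ, hl⟩ := exists_isLeaf hPs.2 (hf b)
    have hbρ := hρ.length_le
    rw [initSeg_length] at hbρ
    obtain ⟨h, hh, hfail⟩ := exists_fails hc hQs.2 hPs.2 hf (List.range ρ.length) ρ
    obtain ⟨y, hy, hyQ⟩ := hΓ _ (prepend_mem_paths hl hh)
    obtain ⟨e, he, i, hi, y', hy', hfe⟩ := hb _ (Part.dom_iff_mem.2 ⟨y, hy⟩)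
    obtain rfl := Part.mem_unique hy hy'
    exact hfail e (List.mem_range.2 (by omega)) i y hi hfe hyQ

/-! ### Deduction of the three statements from the single construction. -/

theorem muchnikReducible_of_forall {P R : Set (ℕ → ℕ)} (H : ∀ g ∈ R, ∃ f ∈ P, TuringLE f g) :
    MuchnikReducible P R := by
  classical
  choose! F hF hle using H
  refine ⟨fun g => ⟨g ∈ R, fun _ => F g⟩, ?_, fun g hg => ⟨F g, ⟨hg, rfl⟩, hF g hg⟩⟩
  rintro g _ ⟨hg, rfl⟩
  exact hle g hg

theorem TeamReducible.mono {Q R R' : Set (ℕ → ℕ)} (h : TeamReducible Q R) (hR : R' ⊆ R) :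
    TeamReducible Q R' := by
  obtain ⟨Γ, hΓ, H⟩ := h
  exact ⟨Γ, hΓ, fun g hg => H g (hR hg)⟩

theorem mainTheorem3 :
    (∀ P Q : Set (ℕ → ℕ), IsPi01Cantor P → IsSpecial P → IsPi01Cantor Q → IsSpecial Q →
      ∃ P' : Set (ℕ → ℕ), IsPi01Cantor P' ∧ MuchnikEquiv P' P ∧ ¬ TeamReducible Q P') ∧
    Level4Separation NonuniformlyComputable TeamLearnable ∧
    (∀ P Q : Set (ℕ → ℕ), IsPi01Cantor P → P.Nonempty → IsPi01Cantor Q → Q.Nonempty →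
      TeamReducible Q (turingUpwardClosure P) → ∃ f ∈ Q, Computable f) := by
  refine ⟨fun P Q hP hPs hQ hQs => ?_, fun Y hY hYs => ?_, fun P Q hP hPn hQ hQn hred => ?_⟩
  · obtain ⟨P', h1, h2, h3, h4⟩ := exists_not_teamReducible hP hPs hQ hQs
    exact ⟨P', h1, ⟨muchnikReducible_of_forall fun g hg => ⟨g, h2 hg, TuringLE.rfl' g⟩,
      muchnikReducible_of_forall h3⟩, h4⟩
  · obtain ⟨X, h1, -, h3, h4⟩ := exists_not_teamReducible hY hYs hY hYs
    exact ⟨X, h1, muchnikReducible_of_forall h3, h4⟩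
  · by_contra! hno
    have hQs : IsSpecial Q := ⟨hQn, hno⟩
    -- With a computable member in `P` the upward closure is all of Cantor space, so the class built
    -- from `Q` alone serves; otherwise `P` is special and its own extension lies in the closure.
    by_cases hPc : ∃ f ∈ P, Computable f
    · obtain ⟨f, hf, hfc⟩ := hPc
      obtain ⟨X, h1, -, -, h4⟩ := exists_not_teamReducible hQ hQs hQ hQs
      refine h4 (hred.mono fun g hg => ⟨h1.1 hg, f, hf, ?_⟩)
      exact Partrec.turingReducible hfc
    · push Not at hPc
      obtain ⟨X, h1, -, h3, h4⟩ := exists_not_teamReducible hP ⟨hPn, hPc⟩ hQ hQs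
      exact h4 (hred.mono fun g hg => ⟨h1.1 hg, h3 g hg⟩)
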